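/- Let $n\ge 0$ be an integer and let $O_n$ be the Lie group of real orthogonal matrices of order $n$, a submanifold of the space $M_n$ of real square matrices of order $n$, endowed with the Riemannian metric $g$ induced by the Frobenius metric $g(V,W)=\operatorname{tr}(V^T W)$ of $M_n$. Two matrices $G,H$ in the same connected component of $O_n$ form a *weakly diametral pair* if there is a geodesic $\gamma:\mathbb{R}\to (O_n,g)$ with $\gamma(0)=G$ and $\gamma(1)=\gamma(-1)=H$. For $p+m=n$ let $\mathcal{N}_{p,m}\subseteq O_n$ be the set of real symmetric orthogonal matrices of order $n$ with the eigenvalue $1$ of multiplicity $p$ and the eigenvalue $-1$ of multiplicity $m$ (a multiplicity may be $0$), and for $G\in O_n$ let $L_G(\mathcal{N}_{p,m})=\{GN : N\in\mathcal{N}_{p,m}\}$. Let $G\in O_n$. Then the set of $H\in O_n$ such that $G,H$ form a weakly diametral pair is the disjoint union $$\bigcup_{q=0}^{\lfloor n/2\rfloor} L_G(\mathcal{N}_{n-2q,\,2q}),$$ where, for every $q=0,\dots,\lfloor n/2\rfloor$, the set $L_G(\mathcal{N}_{n-2q,\,2q})$ is a smooth submanifold of $O_n$, diffeomorphic to the Grassmannian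 $Gr(n-2q,n)$ of $(n-2q)$-dimensional vector subspaces of $\mathbb{R}^n$. -/

import Mathlib

open scoped Matrix.Norms.L2Operator Manifold ContDiff Topology Matrix

/- The opened operator norm on matrices only serves to differentiate matrix valued functions; it
induces the usual topology, and all norms are equivalent. The Riemannian metric is `frobeniusMetric`
below. -/

noncomputable section

/-! ## The Cayley transform -/

/-- The Cayley transform of a square matrix. -/
def cayley {n : ℕ} (M : Matrix (Fin n) (Fin n) ℝ) : Matrix (Fin n) (Fin n) ℝ :=
  (1 - M) * (1 + M)⁻¹

/-- The vector space of real skew symmetric matrices of order `n`. -/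
def SkewMatrix (n : ℕ) : Submodule ℝ (Matrix (Fin n) (Fin n) ℝ) where
  carrier := {A | Aᵀ = -A}
  add_mem' := by
    intro a b ha hb
    simp only [Set.mem_ofPred_eq] at *
    rw [Matrix.transpose_add, ha, hb]; abel
  zero_mem' := by simp
  smul_mem' := by
    intro c a ha
    simp only [Set.mem_ofPred_eq] at *
    rw [Matrix.transpose_smul, ha, smul_neg]

/-- The skew symmetric part of a matrix, as a linear map. -/
def skewPartLin (n : ℕ) : Matrix (Fin n) (Fin n) ℝ →ₗ[ℝ] SkewMatrix n where
  toFun M := ⟨(1 / 2 : ℝ) • (M - Mᵀ), by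
    change ((1 / 2 : ℝ) • (M - Mᵀ))ᵀ = -((1 / 2 : ℝ) • (M - Mᵀ))
    rw [Matrix.transpose_smul, Matrix.transpose_sub, Matrix.transpose_transpose, ← smul_neg,
      neg_sub]⟩
  map_add' a b := by
    ext1
    simp only [Matrix.transpose_add, Submodule.coe_add, ← smul_add]
    congr 1; abel
  map_smul' c a := by
    ext1
    simp only [Matrix.transpose_smul, Submodule.coe_smul, RingHom.id_apply, ← smul_sub]
    rw [smul_comm]

/-- The skew symmetric part of a matrix, as a continuous linear map. -/
def skewPart (n : ℕ) : Matrix (Fin n) (Fin n) ℝ →L[ℝ] SkewMatrix n :=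
  LinearMap.toContinuousLinearMap (skewPartLin n)

theorem skewPart_of_skew {n : ℕ} {M : Matrix (Fin n) (Fin n) ℝ} (h : Mᵀ = -M) :
    ((skewPart n M : SkewMatrix n) : Matrix (Fin n) (Fin n) ℝ) = M := by
  change (1 / 2 : ℝ) • (M - Mᵀ) = M
  rw [h, sub_neg_eq_add, ← two_smul ℝ M, smul_smul]
  norm_num

theorem isUnit_det_one_add_skew {n : ℕ} {X : Matrix (Fin n) (Fin n) ℝ} (h : Xᵀ = -X) :
    IsUnit (1 + X).det := by
  rw [isUnit_iff_ne_zero]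
  intro h0
  obtain ⟨v, hv, hv0⟩ := Matrix.exists_mulVec_eq_zero_iff.mpr h0
  have h1 : v ⬝ᵥ (X *ᵥ v) = 0 := by
    have h2 : v ⬝ᵥ (X *ᵥ v) = -(v ⬝ᵥ (X *ᵥ v)) := by
      conv_lhs => rw [Matrix.dotProduct_mulVec, ← Matrix.mulVec_transpose, h, Matrix.neg_mulVec,
        neg_dotProduct, dotProduct_comm]
    linarith
  have h3 : v ⬝ᵥ v = 0 := by
    have h4 := congrArg (fun w => v ⬝ᵥ w) hv0
    simp only [Matrix.add_mulVec, Matrix.one_mulVec, dotProduct_add, h1, dotProduct_zero,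
      add_zero] at h4
    exact h4
  exact hv (dotProduct_self_eq_zero.mp h3)

theorem one_add_cayley {n : ℕ} {M : Matrix (Fin n) (Fin n) ℝ} (h : IsUnit (1 + M).det) :
    1 + cayley M = (2 : ℝ) • (1 + M)⁻¹ := by
  have h1 : (1 + M) * (1 + M)⁻¹ = 1 := Matrix.mul_nonsing_inv _ h
  have : 1 + cayley M = (1 + M) * (1 + M)⁻¹ + (1 - M) * (1 + M)⁻¹ := by rw [h1, cayley]
  rw [this, ← add_mul, add_add_sub_cancel, ← two_smul ℝ (1 : Matrix (Fin n) (Fin n) ℝ),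
    smul_mul_assoc, one_mul]

theorem isUnit_det_one_add_cayley {n : ℕ} {M : Matrix (Fin n) (Fin n) ℝ}
    (h : IsUnit (1 + M).det) : IsUnit (1 + cayley M).det := by
  rw [one_add_cayley h, Matrix.det_smul]
  exact (isUnit_iff_ne_zero.mpr (by positivity)).mul (Matrix.isUnit_nonsing_inv_det _ h)

theorem cayley_cayley {n : ℕ} {M : Matrix (Fin n) (Fin n) ℝ} (h : IsUnit (1 + M).det) :
    cayley (cayley M) = M := by
  have h1 : (1 + M) * (1 + M)⁻¹ = 1 := Matrix.mul_nonsing_inv _ h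
  have h2 : M * (1 + cayley M) = 1 - cayley M := by
    have e1 : 1 - cayley M = (1 + M) * (1 + M)⁻¹ - (1 - M) * (1 + M)⁻¹ := by rw [h1, cayley]
    rw [one_add_cayley h, e1, ← sub_mul, mul_smul_comm, ← smul_mul_assoc, two_smul]
    congr 1; abel
  rw [cayley, ← h2, mul_assoc, Matrix.mul_nonsing_inv _ (isUnit_det_one_add_cayley h), mul_one]

theorem cayley_skew_mul {n : ℕ} {X : Matrix (Fin n) (Fin n) ℝ} (h : Xᵀ = -X) :
    cayley X * (cayley X)ᵀ = 1 := by
  have hp := isUnit_det_one_add_skew h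
  have hm : IsUnit (1 - X).det := by
    have := isUnit_det_one_add_skew (X := -X) (by rw [Matrix.transpose_neg, h])
    rwa [← sub_eq_add_neg] at this
  have ht : (cayley X)ᵀ = (1 - X)⁻¹ * (1 + X) := by
    rw [cayley, Matrix.transpose_mul, Matrix.transpose_nonsing_inv, Matrix.transpose_add,
      Matrix.transpose_sub, Matrix.transpose_one, h, sub_neg_eq_add, ← sub_eq_add_neg]
  have hc : (1 + X)⁻¹ * (1 - X)⁻¹ = (1 - X)⁻¹ * (1 + X)⁻¹ := by
    rw [← Matrix.mul_inv_rev, ← Matrix.mul_inv_rev]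
    congr 1; noncomm_ring
  calc cayley X * (cayley X)ᵀ
      = (1 - X) * ((1 + X)⁻¹ * (1 - X)⁻¹) * (1 + X) := by rw [ht, cayley]; simp only [mul_assoc]
    _ = ((1 - X) * (1 - X)⁻¹) * ((1 + X)⁻¹ * (1 + X)) := by rw [hc]; simp only [mul_assoc]
    _ = 1 := by rw [Matrix.mul_nonsing_inv _ hm, Matrix.nonsing_inv_mul _ hp, mul_one]

theorem cayley_orthogonal_skew {n : ℕ} {R : Matrix (Fin n) (Fin n) ℝ} (hR : R * Rᵀ = 1)
    (h : IsUnit (1 + R).det) : (cayley R)ᵀ = -cayley R := by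
  have hR' : Rᵀ * R = 1 := mul_eq_one_comm.mp hR
  have ht : IsUnit (1 + Rᵀ).det := by
    have := Matrix.isUnit_det_transpose _ h
    rwa [Matrix.transpose_add, Matrix.transpose_one] at this
  have e1 : (cayley R)ᵀ = (1 + Rᵀ)⁻¹ * (1 - Rᵀ) := by
    rw [cayley, Matrix.transpose_mul, Matrix.transpose_nonsing_inv, Matrix.transpose_add,
      Matrix.transpose_sub, Matrix.transpose_one]
  have e2 : (1 - Rᵀ) * (1 + R) = -((1 + Rᵀ) * (1 - R)) := by
    simp only [sub_mul, mul_sub, add_mul, mul_add, hR', one_mul, mul_one]; abel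
  calc (cayley R)ᵀ = (1 + Rᵀ)⁻¹ * (((1 - Rᵀ) * (1 + R)) * (1 + R)⁻¹) := by
        rw [e1, mul_assoc (1 - Rᵀ), Matrix.mul_nonsing_inv _ h, mul_one]
    _ = -(((1 + Rᵀ)⁻¹ * (1 + Rᵀ)) * ((1 - R) * (1 + R)⁻¹)) := by
        rw [e2]; simp only [neg_mul, mul_neg, mul_assoc]
    _ = -cayley R := by rw [Matrix.nonsing_inv_mul _ ht, one_mul, cayley]

theorem contDiffAt_cayley {n : ℕ} {M : Matrix (Fin n) (Fin n) ℝ} (h : IsUnit (1 + M).det) :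
    ContDiffAt ℝ ∞ (cayley (n := n)) M := by
  have hu : IsUnit (1 + M) := (Matrix.isUnit_iff_isUnit_det _).mpr h
  have h1 : ContDiffAt ℝ ∞ (fun A : Matrix (Fin n) (Fin n) ℝ => (1 + A)⁻¹) M := by
    simp only [Matrix.nonsing_inv_eq_ringInverse]
    have := contDiffAt_ringInverse ℝ (n := ∞) hu.unit
    exact ContDiffAt.comp (g := Ring.inverse) M this (contDiffAt_const.add contDiffAt_id)
  exact (contDiffAt_const.sub contDiffAt_id).mul h1

/-! ## The orthogonal group as a smooth manifold -/

/-- The group of real orthogonal matrices of order `n`, with the subspace topology. -/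
abbrev OrthGroup (n : ℕ) : Type := Matrix.orthogonalGroup (Fin n) ℝ

theorem OrthGroup.mul_transpose {n : ℕ} (Q : OrthGroup n) :
    (Q : Matrix (Fin n) (Fin n) ℝ) * (Q : Matrix (Fin n) (Fin n) ℝ)ᵀ = 1 :=
  (Matrix.mem_orthogonalGroup_iff (Fin n) ℝ).mp Q.2

theorem OrthGroup.transpose_mul {n : ℕ} (Q : OrthGroup n) :
    (Q : Matrix (Fin n) (Fin n) ℝ)ᵀ * (Q : Matrix (Fin n) (Fin n) ℝ) = 1 :=
  mul_eq_one_comm.mp Q.mul_transpose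

/-- The orthogonal matrix which is the Cayley transform of a skew symmetric matrix. -/
def cayleyOrth {n : ℕ} (X : SkewMatrix n) : OrthGroup n :=
  ⟨cayley (X : Matrix (Fin n) (Fin n) ℝ),
    (Matrix.mem_orthogonalGroup_iff (Fin n) ℝ).mpr (cayley_skew_mul X.2)⟩

/-- The Cayley chart of the orthogonal group centred at `Q`: it sends `R` to the Cayley transform
of `Qᵀ R`, on the open set where `1 + Qᵀ R` is invertible (there the Cayley transform is already
skew symmetric, so that taking the skew symmetric part changes nothing), and its inverse is
`X ↦ Q (1 - X) (1 + X)⁻¹`. -/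
def cayleyChart {n : ℕ} (Q : OrthGroup n) : OpenPartialHomeomorph (OrthGroup n) (SkewMatrix n) where
  toFun R := skewPart n (cayley ((Q : Matrix (Fin n) (Fin n) ℝ)ᵀ * (R : Matrix (Fin n) (Fin n) ℝ)))
  invFun X := Q * cayleyOrth X
  source := {R | IsUnit (1 + (Q : Matrix (Fin n) (Fin n) ℝ)ᵀ * (R : Matrix (Fin n) (Fin n) ℝ)).det}
  target := Set.univ
  map_source' _ _ := Set.mem_univ _
  map_target' X _ := by
    change IsUnit (1 + (Q : Matrix (Fin n) (Fin n) ℝ)ᵀ *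
      ((Q : Matrix (Fin n) (Fin n) ℝ) * cayley (X : Matrix (Fin n) (Fin n) ℝ))).det
    rw [← mul_assoc, Q.transpose_mul, one_mul]
    exact isUnit_det_one_add_cayley (isUnit_det_one_add_skew X.2)
  left_inv' R hR := by
    have h1 : ((Q : Matrix (Fin n) (Fin n) ℝ)ᵀ * (R : Matrix (Fin n) (Fin n) ℝ)) *
        ((Q : Matrix (Fin n) (Fin n) ℝ)ᵀ * (R : Matrix (Fin n) (Fin n) ℝ))ᵀ = 1 := by
      rw [Matrix.transpose_mul, Matrix.transpose_transpose, mul_assoc,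
        ← mul_assoc (R : Matrix (Fin n) (Fin n) ℝ), R.mul_transpose, one_mul, Q.transpose_mul]
    apply Subtype.ext
    change (Q : Matrix (Fin n) (Fin n) ℝ) * cayley ((skewPart n (cayley
      ((Q : Matrix (Fin n) (Fin n) ℝ)ᵀ * (R : Matrix (Fin n) (Fin n) ℝ))) : SkewMatrix n) :
        Matrix (Fin n) (Fin n) ℝ) = R
    rw [skewPart_of_skew (cayley_orthogonal_skew h1 hR), cayley_cayley hR, ← mul_assoc,
      Q.mul_transpose, one_mul]
  right_inv' X _ := by
    apply Subtype.ext
    change ((skewPart n (cayley ((Q : Matrix (Fin n) (Fin n) ℝ)ᵀ *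
      ((Q : Matrix (Fin n) (Fin n) ℝ) * cayley (X : Matrix (Fin n) (Fin n) ℝ)))) : SkewMatrix n) :
        Matrix (Fin n) (Fin n) ℝ) = X
    rw [← mul_assoc, Q.transpose_mul, one_mul, cayley_cayley (isUnit_det_one_add_skew X.2)]
    exact skewPart_of_skew X.2
  open_source := by
    simp only [isUnit_iff_ne_zero]
    refine isOpen_ne_fun ?_ continuous_const
    exact (continuous_const.add (continuous_const.mul continuous_subtype_val)).matrix_det
  open_target := isOpen_univ
  continuousOn_toFun := by
    intro R hR
    have h1 := (contDiffAt_cayley hR).continuousAt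
    have h2 : ContinuousAt (fun S : OrthGroup n =>
        (Q : Matrix (Fin n) (Fin n) ℝ)ᵀ * (S : Matrix (Fin n) (Fin n) ℝ)) R :=
      (continuous_const.mul continuous_subtype_val).continuousAt
    have h3 := ContinuousAt.comp (f := fun S : OrthGroup n =>
        (Q : Matrix (Fin n) (Fin n) ℝ)ᵀ * (S : Matrix (Fin n) (Fin n) ℝ)) h1 h2
    exact ((skewPart n).continuous.continuousAt.comp h3).continuousWithinAt
  continuousOn_invFun := by
    refine Continuous.continuousOn ?_
    refine Continuous.subtype_mk (continuous_const.mul ?_) _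
    rw [continuous_iff_continuousAt]
    intro X
    exact ContinuousAt.comp (f := fun Y : SkewMatrix n => (Y : Matrix (Fin n) (Fin n) ℝ))
      (contDiffAt_cayley (isUnit_det_one_add_skew X.2)).continuousAt
      continuous_subtype_val.continuousAt

/-- The orthogonal group as a manifold modelled on the skew symmetric matrices. The inverse Cayley
charts are smooth immersions into the space of matrices, so that this is the structure that the
orthogonal group has as a submanifold of the space of matrices. -/
instance OrthGroup.instChartedSpace (n : ℕ) : ChartedSpace (SkewMatrix n) (OrthGroup n) where
  atlas := Set.range cayleyChart
  chartAt := cayleyChart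
  mem_chart_source Q := by
    change IsUnit (1 + (Q : Matrix (Fin n) (Fin n) ℝ)ᵀ * (Q : Matrix (Fin n) (Fin n) ℝ)).det
    rw [Q.transpose_mul]
    have : (1 : Matrix (Fin n) (Fin n) ℝ) + 1 = (2 : ℝ) • 1 := by rw [two_smul]
    rw [this, Matrix.det_smul, Matrix.det_one, mul_one]
    exact isUnit_iff_ne_zero.mpr (by positivity)
  chart_mem_atlas Q := Set.mem_range_self Q

instance OrthGroup.instIsManifold (n : ℕ) : IsManifold 𝓘(ℝ, SkewMatrix n) ∞ (OrthGroup n) := by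
  apply isManifold_of_contDiffOn
  rintro _ _ ⟨Q, rfl⟩ ⟨Q', rfl⟩
  intro X hX
  have hX' : IsUnit (1 + (Q' : Matrix (Fin n) (Fin n) ℝ)ᵀ *
      ((Q : Matrix (Fin n) (Fin n) ℝ) * cayley (X : Matrix (Fin n) (Fin n) ℝ))).det := by
    have := hX.1
    simp only [mfld_simps] at this
    exact this.2
  have h1 : ContDiffAt ℝ ∞ (fun Y : SkewMatrix n => (Q' : Matrix (Fin n) (Fin n) ℝ)ᵀ *
      ((Q : Matrix (Fin n) (Fin n) ℝ) * cayley (Y : Matrix (Fin n) (Fin n) ℝ))) X := by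
    refine contDiffAt_const.mul (contDiffAt_const.mul ?_)
    exact ContDiffAt.comp (f := fun Y : SkewMatrix n => (Y : Matrix (Fin n) (Fin n) ℝ)) X
      (contDiffAt_cayley (isUnit_det_one_add_skew X.2)) (SkewMatrix n).subtypeL.contDiff.contDiffAt
  have h2 := ContDiffAt.comp (g := cayley (n := n)) X (contDiffAt_cayley hX') h1
  exact ((skewPart n).contDiff.contDiffAt.comp X h2).contDiffWithinAt

/-! ## The Grassmannian as a smooth manifold -/

/-- The Grassmannian of `p`-dimensional vector subspaces of `ℝⁿ`. -/
def Gr (p n : ℕ) : Type := {W : Submodule ℝ (Fin n → ℝ) // Module.finrank ℝ W = p}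

/-- The model space of the Grassmannian: linear maps from `ℝᵖ` to `ℝⁿ⁻ᵖ`. -/
abbrev GrModel (p n : ℕ) : Type := (Fin p → ℝ) →L[ℝ] (Fin (n - p) → ℝ)

/-- A linear splitting of `ℝⁿ` as the sum of `ℝᵖ` and `ℝⁿ⁻ᵖ`. -/
abbrev GrFrame (p n : ℕ) : Type := ((Fin p → ℝ) × (Fin (n - p) → ℝ)) ≃L[ℝ] (Fin n → ℝ)

/-- The affine parametrization of the Grassmannian attached to a splitting of `ℝⁿ`: a linear map
is sent to (the image in `ℝⁿ` of) its graph. -/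
def grParam {p n : ℕ} (e : GrFrame p n) (T : GrModel p n) : Gr p n :=
  ⟨(LinearMap.graph (T : (Fin p → ℝ) →ₗ[ℝ] (Fin (n - p) → ℝ))).map
      (e.toLinearEquiv : ((Fin p → ℝ) × (Fin (n - p) → ℝ)) →ₗ[ℝ] (Fin n → ℝ)), by
    rw [LinearEquiv.finrank_map_eq, LinearMap.graph_eq_range_prod,
      LinearMap.finrank_range_of_inj (fun x y h => (Prod.ext_iff.mp h).1)]
    simp⟩

theorem mem_grParam {p n : ℕ} (e : GrFrame p n) (T : GrModel p n) (v : Fin n → ℝ) :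
    v ∈ (grParam e T).1 ↔ (e.symm v).2 = T (e.symm v).1 := by
  constructor
  · rintro ⟨x, hx, rfl⟩
    have hx' : x.2 = T x.1 := hx
    simpa using hx'
  · intro h
    exact ⟨e.symm v, h, by simp⟩

theorem grParam_injective {p n : ℕ} (e : GrFrame p n) : Function.Injective (grParam e) := by
  intro T T' h
  ext1 x
  have h1 : e (x, T x) ∈ (grParam e T).1 := (mem_grParam _ _ _).mpr (by simp)
  rw [h, mem_grParam] at h1
  simpa using h1

/-- The affine chart of the Grassmannian attached to a splitting of `ℝⁿ`: the inverse of the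
corresponding parametrization. -/
def grChart {p n : ℕ} (e : GrFrame p n) : PartialEquiv (Gr p n) (GrModel p n) where
  toFun := Function.invFun (grParam e)
  invFun := grParam e
  source := Set.range (grParam e)
  target := Set.univ
  map_source' _ _ := Set.mem_univ _
  map_target' T _ := Set.mem_range_self T
  left_inv' := by
    rintro _ ⟨T, rfl⟩
    rw [Function.leftInverse_invFun (grParam_injective e) T]
  right_inv' T _ := Function.leftInverse_invFun (grParam_injective e) T

/-- Every subspace of dimension `p` is the origin of some affine chart. -/
theorem exists_grFrame {p n : ℕ} (W : Gr p n) : ∃ e : GrFrame p n, grParam e 0 = W := by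
  obtain ⟨W, hW⟩ := W
  obtain ⟨C, hC⟩ := Submodule.exists_isCompl W
  have h1 : Module.finrank ℝ C = n - p := by
    have := Submodule.finrank_add_eq_of_isCompl hC
    rw [hW, Module.finrank_fin_fun] at this
    omega
  let f : (Fin p → ℝ) ≃ₗ[ℝ] W := LinearEquiv.ofFinrankEq _ _ (by rw [hW, Module.finrank_fin_fun])
  let g : (Fin (n - p) → ℝ) ≃ₗ[ℝ] C :=
    LinearEquiv.ofFinrankEq _ _ (by rw [h1, Module.finrank_fin_fun])
  let e : ((Fin p → ℝ) × (Fin (n - p) → ℝ)) ≃ₗ[ℝ] (Fin n → ℝ) :=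
    (f.prodCongr g).trans (Submodule.prodEquivOfIsCompl W C hC)
  refine ⟨e.toContinuousLinearEquiv, ?_⟩
  apply Subtype.ext
  ext v
  rw [mem_grParam]
  obtain ⟨⟨x, y⟩, rfl⟩ := e.surjective v
  have h2 : e.toContinuousLinearEquiv.symm (e (x, y)) = (x, y) :=
    e.symm_apply_apply (x, y)
  have h3 : e (x, y) = (f x : Fin n → ℝ) + (g y : Fin n → ℝ) := rfl
  rw [h2, h3]
  change y = 0 ↔ _
  rw [W.add_mem_iff_right (f x).2]
  constructor
  · rintro rfl; simp
  · intro h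
    have h4 : (g y : Fin n → ℝ) ∈ W ⊓ C := ⟨h, (g y).2⟩
    rw [hC.inf_eq_bot, Submodule.mem_bot] at h4
    have h5 : g y = 0 := Subtype.ext h4
    simpa using h5

/-- For two splittings `e, e'`, the map `T ↦ π₁ ∘ e'⁻¹ ∘ e ∘ (id, T)`. -/
def grTransFst {p n : ℕ} (e e' : GrFrame p n) (T : GrModel p n) :
    (Fin p → ℝ) →L[ℝ] (Fin p → ℝ) :=
  (ContinuousLinearMap.fst ℝ _ _ ∘L ((e.trans e'.symm).toContinuousLinearMap)) ∘L
    (ContinuousLinearMap.inl ℝ _ _ + ContinuousLinearMap.inr ℝ _ _ ∘L T)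

/-- For two splittings `e, e'`, the map `T ↦ π₂ ∘ e'⁻¹ ∘ e ∘ (id, T)`. -/
def grTransSnd {p n : ℕ} (e e' : GrFrame p n) (T : GrModel p n) :
    (Fin p → ℝ) →L[ℝ] (Fin (n - p) → ℝ) :=
  (ContinuousLinearMap.snd ℝ _ _ ∘L ((e.trans e'.symm).toContinuousLinearMap)) ∘L
    (ContinuousLinearMap.inl ℝ _ _ + ContinuousLinearMap.inr ℝ _ _ ∘L T)

theorem grTrans_apply {p n : ℕ} (e e' : GrFrame p n) (T : GrModel p n) (x : Fin p → ℝ) :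
    e'.symm (e (x, T x)) = (grTransFst e e' T x, grTransSnd e e' T x) := by
  have h1 : ((x, T x) : (Fin p → ℝ) × (Fin (n - p) → ℝ)) = (x, 0) + (0, T x) := by simp
  rw [h1, map_add, map_add]
  simp [grTransFst, grTransSnd, Prod.ext_iff]

theorem grTransSnd_eq {p n : ℕ} {e e' : GrFrame p n} {T T' : GrModel p n}
    (h : grParam e' T' = grParam e T) : grTransSnd e e' T = T' ∘L grTransFst e e' T := by
  ext1 x
  have h1 : e (x, T x) ∈ (grParam e T).1 := (mem_grParam _ _ _).mpr (by simp)
  rw [← h, mem_grParam, grTrans_apply] at h1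
  exact h1

theorem grTransFst_isInvertible {p n : ℕ} {e e' : GrFrame p n} {T T' : GrModel p n}
    (h : grParam e' T' = grParam e T) : (grTransFst e e' T).IsInvertible := by
  have hinj : Function.Injective (grTransFst e e' T) := by
    rw [injective_iff_map_eq_zero]
    intro x hx
    have h1 := grTrans_apply e e' T x
    rw [grTransSnd_eq h, ContinuousLinearMap.comp_apply, hx, map_zero] at h1
    have h2 : e'.symm (e (x, T x)) = 0 := h1
    simpa using (Prod.ext_iff.mp ((map_eq_zero_iff _ e.injective).mp
      ((map_eq_zero_iff _ e'.symm.injective).mp h2))).1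
  let A : (Fin p → ℝ) ≃ₗ[ℝ] (Fin p → ℝ) :=
    LinearEquiv.ofInjectiveEndo (grTransFst e e' T : (Fin p → ℝ) →ₗ[ℝ] (Fin p → ℝ)) hinj
  exact ⟨A.toContinuousLinearEquiv, by ext1 x; rfl⟩

theorem grParam_trans {p n : ℕ} {e e' : GrFrame p n} {T : GrModel p n}
    (h : (grTransFst e e' T).IsInvertible) :
    grParam e' (grTransSnd e e' T ∘L (grTransFst e e' T).inverse) = grParam e T := by
  obtain ⟨A, hA⟩ := h
  apply Subtype.ext
  symm
  apply Submodule.eq_of_le_of_finrank_eq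
  · intro v hv
    rw [mem_grParam] at hv ⊢
    have h1 : v = e ((e.symm v).1, T (e.symm v).1) := by
      rw [← hv]; simp
    have h2 := grTrans_apply e e' T (e.symm v).1
    rw [← h1] at h2
    rw [h2, ← hA, ContinuousLinearMap.inverse_equiv]
    simp
  · rw [(grParam e T).2, (grParam e' _).2]

theorem mem_grChart_trans_source {p n : ℕ} (e e' : GrFrame p n) (T : GrModel p n) :
    T ∈ ((grChart e).symm.trans (grChart e')).source ↔ (grTransFst e e' T).IsInvertible := by
  have : T ∈ ((grChart e).symm.trans (grChart e')).source ↔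
      grParam e T ∈ Set.range (grParam e') := by
    rw [PartialEquiv.trans_source]
    exact ⟨fun h => h.2, fun h => ⟨Set.mem_univ _, h⟩⟩
  rw [this]
  constructor
  · rintro ⟨T', h⟩
    exact grTransFst_isInvertible h
  · intro h
    exact ⟨_, grParam_trans h⟩

theorem grChart_trans_apply {p n : ℕ} {e e' : GrFrame p n} {T : GrModel p n}
    (h : (grTransFst e e' T).IsInvertible) :
    ((grChart e).symm.trans (grChart e')) T =
      grTransSnd e e' T ∘L (grTransFst e e' T).inverse := by
  change Function.invFun (grParam e') (grParam e T) = _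
  rw [← grParam_trans h]
  exact Function.leftInverse_invFun (grParam_injective e') _

theorem contDiff_grTransFst {p n : ℕ} (e e' : GrFrame p n) : ContDiff ℝ ∞ (grTransFst e e') := by
  unfold grTransFst
  exact contDiff_const.clm_comp (contDiff_const.add (contDiff_const.clm_comp contDiff_id))

theorem contDiff_grTransSnd {p n : ℕ} (e e' : GrFrame p n) : ContDiff ℝ ∞ (grTransSnd e e') := by
  unfold grTransSnd
  exact contDiff_const.clm_comp (contDiff_const.add (contDiff_const.clm_comp contDiff_id))

theorem isOpen_grChart_trans_source {p n : ℕ} (e e' : GrFrame p n) :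
    IsOpen ((grChart e).symm.trans (grChart e')).source := by
  have : ((grChart e).symm.trans (grChart e')).source = grTransFst e e' ⁻¹'
      Set.range ((↑) : ((Fin p → ℝ) ≃L[ℝ] (Fin p → ℝ)) → (Fin p → ℝ) →L[ℝ] (Fin p → ℝ)) := by
    ext T
    exact mem_grChart_trans_source e e' T
  rw [this]
  exact ContinuousLinearEquiv.isOpen.preimage (contDiff_grTransFst e e').continuous

theorem contDiffOn_grChart_trans {p n : ℕ} (e e' : GrFrame p n) :
    ContDiffOn ℝ ∞ ((grChart e).symm.trans (grChart e'))
      ((grChart e).symm.trans (grChart e')).source := by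
  have h1 : ContDiffOn ℝ ∞ (fun T => grTransSnd e e' T ∘L (grTransFst e e' T).inverse)
      ((grChart e).symm.trans (grChart e')).source := by
    intro T hT
    rw [mem_grChart_trans_source] at hT
    refine ContDiffAt.contDiffWithinAt ?_
    refine (contDiff_grTransSnd e e').contDiffAt.clm_comp ?_
    obtain ⟨A, hA⟩ := hT
    refine ContDiffAt.comp (g := ContinuousLinearMap.inverse) T ?_
      (contDiff_grTransFst e e').contDiffAt
    rw [← hA]
    exact contDiffAt_map_inverse A
  exact h1.congr fun T hT => grChart_trans_apply ((mem_grChart_trans_source e e' T).mp hT)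

/-- The affine charts of the Grassmannian, with their compatibility. -/
def grCore (p n : ℕ) : ChartedSpaceCore (GrModel p n) (Gr p n) where
  atlas := Set.range grChart
  chartAt W := grChart (exists_grFrame W).choose
  mem_chart_source W := ⟨0, (exists_grFrame W).choose_spec⟩
  chart_mem_atlas W := Set.mem_range_self _
  open_source := by
    rintro _ _ ⟨e, rfl⟩ ⟨e', rfl⟩
    exact isOpen_grChart_trans_source e e'
  continuousOn_toFun := by
    rintro _ _ ⟨e, rfl⟩ ⟨e', rfl⟩
    exact (contDiffOn_grChart_trans e e').continuousOn

/-- The topology of the Grassmannian. -/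
instance Gr.instTopologicalSpace (p n : ℕ) : TopologicalSpace (Gr p n) :=
  (grCore p n).toTopologicalSpace

/-- The Grassmannian as a manifold, with the affine charts. -/
instance Gr.instChartedSpace (p n : ℕ) : ChartedSpace (GrModel p n) (Gr p n) :=
  (grCore p n).toChartedSpace

instance Gr.instIsManifold (p n : ℕ) : IsManifold 𝓘(ℝ, GrModel p n) ∞ (Gr p n) := by
  apply isManifold_of_contDiffOn
  intro f f' hf hf'
  obtain ⟨_, ⟨e, rfl⟩, h1⟩ := Set.mem_iUnion₂.mp hf
  obtain ⟨_, ⟨e', rfl⟩, h2⟩ := Set.mem_iUnion₂.mp hf'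
  obtain rfl := Set.mem_singleton_iff.mp h1
  obtain rfl := Set.mem_singleton_iff.mp h2
  exact (contDiffOn_grChart_trans e e').mono fun T hT => hT.1

/-! ## Submanifolds -/

/-- `S` is a smooth (embedded) submanifold of the manifold `M`: around each of its points there is
a smooth chart of `M` in which `S` is a linear slice. -/
def IsSubmanifold (E : Type*) [NormedAddCommGroup E] [NormedSpace ℝ E] {M : Type*}
    [TopologicalSpace M] [ChartedSpace E M] (S : Set M) : Prop :=
  ∀ x ∈ S, ∃ φ ∈ IsManifold.maximalAtlas 𝓘(ℝ, E) ∞ M, x ∈ φ.source ∧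
    ∃ F : Submodule ℝ E, φ '' (φ.source ∩ S) = φ.target ∩ F

/-! ## Geodesics of the orthogonal group and weakly diametral pairs -/

/-- The Frobenius metric. -/
def frobeniusMetric {n : ℕ} (V W : Matrix (Fin n) (Fin n) ℝ) : ℝ := (Vᵀ * W).trace

/-- A curve in the orthogonal group, seen as a curve of matrices. -/
def matrixCurve {n : ℕ} (γ : ℝ → OrthGroup n) (t : ℝ) : Matrix (Fin n) (Fin n) ℝ := γ t

/-- The tangent space of the orthogonal group at `G`: the velocities at `G` of the smooth curves
of the orthogonal group. -/
def tangentVectors {n : ℕ} (G : OrthGroup n) : Set (Matrix (Fin n) (Fin n) ℝ) :=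
  {V | ∃ c : ℝ → OrthGroup n, ContDiff ℝ ∞ (matrixCurve c) ∧ c 0 = G ∧
    HasDerivAt (matrixCurve c) V 0}

/-- A geodesic of the orthogonal group with the Riemannian metric induced by the Frobenius metric:
a smooth curve whose covariant derivative, i.e. the orthogonal projection of its acceleration on
the tangent space, is zero at all times. -/
def IsGeodesic {n : ℕ} (γ : ℝ → OrthGroup n) : Prop :=
  ContDiff ℝ ∞ (matrixCurve γ) ∧
    ∀ t : ℝ, ∀ V ∈ tangentVectors (γ t), frobeniusMetric (deriv (deriv (matrixCurve γ)) t) V = 0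

/-- `G` and `H` form a weakly diametral pair: they lie in the same connected component of the
orthogonal group and some geodesic is at `G` at time `0` and at `H` at the times `1` and `-1`. -/
def IsWeaklyDiametral {n : ℕ} (G H : OrthGroup n) : Prop :=
  H ∈ connectedComponent G ∧
    ∃ γ : ℝ → OrthGroup n, IsGeodesic γ ∧ γ 0 = G ∧ γ 1 = H ∧ γ (-1) = H

/-- The set of real symmetric orthogonal matrices of order `n` with the eigenvalue `1` of
multiplicity `p` and the eigenvalue `-1` of multiplicity `m`. -/
def SymmOrth (n p m : ℕ) : Set (OrthGroup n) :=
  {N | (N : Matrix (Fin n) (Fin n) ℝ).IsSymm ∧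
    Module.finrank ℝ (Module.End.eigenspace
      (Matrix.toLin' (N : Matrix (Fin n) (Fin n) ℝ)) 1) = p ∧
    Module.finrank ℝ (Module.End.eigenspace
      (Matrix.toLin' (N : Matrix (Fin n) (Fin n) ℝ)) (-1)) = m}

/-- The left translate by `G` of the set of real symmetric orthogonal matrices with the eigenvalue
`1` of multiplicity `n - 2q` and the eigenvalue `-1` of multiplicity `2q`. -/
def diametralPiece {n : ℕ} (G : OrthGroup n) (q : ℕ) : Set (OrthGroup n) :=
  (fun N => G * N) '' SymmOrth n (n - 2 * q) (2 * q)

end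

/-! ## Symmetric involutions -/

/-! A curve `γ` in the orthogonal group is a geodesic iff `γᵀ γ''` is symmetric (`isGeodesic_iff`);
since `γᵀ γ'` is skew, this forces it to be a constant `A`, so `γ t = G exp(tA)`
(`IsGeodesic.eq_mul_exp`). Then `γ 1 = γ (-1)` says that `N = G⁻¹H = exp A` equals `exp(-A) = Nᵀ`.
So `N` is a symmetric involution, and being the square of `exp(A/2)` it has `-1` with even
multiplicity (`even_finrank_eigenspace_neg_one`). Conversely, an even-dimensional `-1`-eigenspace
carries an orthogonal complex structure `J`, and `t ↦ G exp(πtJ)` is a geodesic through `GN` at `t =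
±1`.

For the geometry of the pieces, `N * cayley X` is symmetric iff `X` anticommutes with `N`
(`isSymm_mul_cayley_iff`), so the Cayley chart centred at a point of a piece turns the piece into a
linear slice. Sending a subspace `W` to `G` times the reflection across `W` maps the Grassmannian
bijectively onto the piece. In an affine chart built from the two eigenspaces and in the Cayley
chart, this map is the injective linear map `frameSkew` (`grReflection_grParam`), with left inverse
`frameBlock`. This gives both the immersion and the topological embedding. -/

theorem mem_eigenspace_toLin' {n : ℕ} {N : Matrix (Fin n) (Fin n) ℝ} {c : ℝ} {v : Fin n → ℝ} :
    v ∈ Module.End.eigenspace (Matrix.toLin' N) c ↔ N *ᵥ v = c • v := by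
  rw [Module.End.mem_eigenspace_iff, Matrix.toLin'_apply]

theorem mem_eigenspace_one {n : ℕ} {N : Matrix (Fin n) (Fin n) ℝ} {v : Fin n → ℝ} :
    v ∈ Module.End.eigenspace (Matrix.toLin' N) 1 ↔ N *ᵥ v = v := by
  rw [mem_eigenspace_toLin', one_smul]

theorem mem_eigenspace_neg_one {n : ℕ} {N : Matrix (Fin n) (Fin n) ℝ} {v : Fin n → ℝ} :
    v ∈ Module.End.eigenspace (Matrix.toLin' N) (-1) ↔ N *ᵥ v = -v := by
  rw [mem_eigenspace_toLin', neg_one_smul]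

theorem OrthGroup.mul_self {n : ℕ} {N : OrthGroup n}
    (hN : (N : Matrix (Fin n) (Fin n) ℝ).IsSymm) :
    (N : Matrix (Fin n) (Fin n) ℝ) * (N : Matrix (Fin n) (Fin n) ℝ) = 1 := by
  have := N.mul_transpose
  rwa [hN.eq] at this

theorem isSymm_of_mul_self {n : ℕ} {N : OrthGroup n}
    (hN : (N : Matrix (Fin n) (Fin n) ℝ) * (N : Matrix (Fin n) (Fin n) ℝ) = 1) :
    (N : Matrix (Fin n) (Fin n) ℝ).IsSymm := by
  calc (N : Matrix (Fin n) (Fin n) ℝ)ᵀ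
      = (N : Matrix (Fin n) (Fin n) ℝ)ᵀ * ((N : Matrix (Fin n) (Fin n) ℝ) *
          (N : Matrix (Fin n) (Fin n) ℝ)) := by rw [hN, mul_one]
    _ = N := by rw [← mul_assoc, N.transpose_mul, one_mul]

/-- The eigenspaces of an involution are complementary. -/
theorem isCompl_eigenspace {n : ℕ} {N : Matrix (Fin n) (Fin n) ℝ} (hN : N * N = 1) :
    IsCompl (Module.End.eigenspace (Matrix.toLin' N) 1)
      (Module.End.eigenspace (Matrix.toLin' N) (-1)) := by
  constructor
  · rw [Submodule.disjoint_def]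
    intro v h1 h2
    rw [mem_eigenspace_one] at h1
    rw [mem_eigenspace_neg_one, h1] at h2
    exact self_eq_neg.mp h2
  · rw [codisjoint_iff, Submodule.eq_top_iff']
    intro v
    have hv : N *ᵥ (N *ᵥ v) = v := by rw [Matrix.mulVec_mulVec, hN, Matrix.one_mulVec]
    refine Submodule.mem_sup.mpr ⟨(1 / 2 : ℝ) • (v + N *ᵥ v), ?_, (1 / 2 : ℝ) • (v - N *ᵥ v), ?_, ?_⟩
    · rw [mem_eigenspace_one, Matrix.mulVec_smul, Matrix.mulVec_add, hv, add_comm]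
    · rw [mem_eigenspace_neg_one, Matrix.mulVec_smul, Matrix.mulVec_sub, hv, ← smul_neg, neg_sub]
    · rw [← smul_add, add_add_sub_cancel, ← two_smul ℝ v, smul_smul]
      norm_num

theorem finrank_eigenspace_add {n : ℕ} {N : Matrix (Fin n) (Fin n) ℝ} (hN : N * N = 1) :
    Module.finrank ℝ (Module.End.eigenspace (Matrix.toLin' N) 1) +
      Module.finrank ℝ (Module.End.eigenspace (Matrix.toLin' N) (-1)) = n := by
  have := Submodule.finrank_add_eq_of_isCompl (isCompl_eigenspace hN)
  rwa [Module.finrank_fin_fun] at this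

/-- A symmetric involution is determined by its eigenspace for the eigenvalue `1`. -/
theorem eq_of_eigenspace_one_eq {n : ℕ} {N N' : Matrix (Fin n) (Fin n) ℝ} (hN : N.IsSymm)
    (hN' : N'.IsSymm) (h : N * N = 1) (h' : N' * N' = 1)
    (he : Module.End.eigenspace (Matrix.toLin' N) 1 =
      Module.End.eigenspace (Matrix.toLin' N') 1) : N = N' := by
  -- The range of `1 + A` consists of vectors fixed by `A`, hence by `B`.
  have key : ∀ {A B : Matrix (Fin n) (Fin n) ℝ}, A * A = 1 →
      Module.End.eigenspace (Matrix.toLin' A) 1 ≤ Module.End.eigenspace (Matrix.toLin' B) 1 →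
      B * (1 + A) = 1 + A := by
    intro A B hA hAB
    refine Matrix.toLin'.injective (LinearMap.ext fun v => ?_)
    rw [Matrix.toLin'_mul_apply]
    refine mem_eigenspace_one.mp (hAB (mem_eigenspace_one.mpr ?_))
    rw [Matrix.toLin'_apply, Matrix.mulVec_mulVec, mul_add, hA, mul_one, add_comm]
  have h1 := key h he.le
  have h2 := key h' he.ge
  -- By symmetry, transposing turns `N' * N` into `N * N'`, the product that also occurs in `h2`;
  -- subtracting eliminates it.
  have h3 := congrArg Matrix.transpose h1
  rw [Matrix.transpose_mul, Matrix.transpose_add, Matrix.transpose_one, hN.eq, hN'.eq, add_mul,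
    one_mul] at h3
  rw [mul_add, mul_one] at h2
  have h4 : N' - N = N - N' := by
    have : N' - N = (N' + N * N') - (N + N * N') := by abel
    rw [this, h3, h2]; abel
  have h5 : (2 : ℝ) • (N - N') = 0 := by
    rw [two_smul]
    nth_rewrite 1 [← h4]
    abel
  exact sub_eq_zero.mp ((smul_eq_zero.mp h5).resolve_left two_ne_zero)

/-- Every subspace of `ℝⁿ` is spanned by the columns of a matrix with orthonormal columns. -/
theorem exists_orthonormal_columns {n : ℕ} {ι : Type*} [Fintype ι] [DecidableEq ι]
    (W : Submodule ℝ (Fin n → ℝ)) (h : Module.finrank ℝ W = Fintype.card ι) :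
    ∃ B : Matrix (Fin n) ι ℝ, Bᵀ * B = 1 ∧ LinearMap.range (Matrix.toLin' B) = W := by
  -- `Fin n → ℝ` carries the sup norm; the orthonormal basis is taken in the Euclidean copy of the
  -- space.
  let L : (Fin n → ℝ) ≃ₗ[ℝ] EuclideanSpace ℝ (Fin n) := (WithLp.linearEquiv 2 ℝ (Fin n → ℝ)).symm
  let W' : Submodule ℝ (EuclideanSpace ℝ (Fin n)) := W.map (L : _ →ₗ[ℝ] _)
  have hW' : Module.finrank ℝ W' = Fintype.card ι := by
    rw [← h]; exact LinearEquiv.finrank_map_eq L W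
  let b : OrthonormalBasis ι ℝ W' := (stdOrthonormalBasis ℝ W').reindex
    (Fintype.equivOfCardEq (by rw [Fintype.card_fin, hW']))
  let B : Matrix (Fin n) ι ℝ := fun i j => (b j : EuclideanSpace ℝ (Fin n)) i
  have hb : ∀ j, (fun i => B i j) ∈ W := by
    intro j
    obtain ⟨w, hw, hw'⟩ := (b j).2
    have : (fun i => B i j) = w := by
      ext i
      change (b j : EuclideanSpace ℝ (Fin n)) i = w i
      rw [← hw']; rfl
    rwa [this]
  have hB : Bᵀ * B = 1 := by
    ext i j
    have h1 := orthonormal_iff_ite.mp b.orthonormal i j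
    rw [Submodule.coe_inner, PiLp.inner_apply] at h1
    rw [Matrix.mul_apply, Matrix.one_apply, ← h1]
    exact Finset.sum_congr rfl fun k _ => mul_comm _ _
  refine ⟨B, hB, ?_⟩
  apply Submodule.eq_of_le_of_finrank_eq
  · rintro _ ⟨x, rfl⟩
    rw [Matrix.toLin'_apply, Matrix.mulVec_eq_sum]
    refine Submodule.sum_mem _ fun j _ => ?_
    rw [op_smul_eq_smul]
    exact Submodule.smul_mem _ _ (hb j)
  · rw [LinearMap.finrank_range_of_inj, h, Module.finrank_fintype_fun_eq_card]
    intro x y hxy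
    have := congrArg (fun v => Bᵀ *ᵥ v) hxy
    simpa [Matrix.mulVec_mulVec, hB] using this

/-! ### The reflection across the span of orthonormal columns -/

section Reflection

variable {n : ℕ} {ι : Type*} [Fintype ι]

theorem projection_mul_self [DecidableEq ι] {B : Matrix (Fin n) ι ℝ} (hB : Bᵀ * B = 1) : (B * Bᵀ) * (B * Bᵀ) = B * Bᵀ := by
  rw [Matrix.mul_assoc, ← Matrix.mul_assoc Bᵀ, hB, Matrix.one_mul]

theorem isSymm_reflection (B : Matrix (Fin n) ι ℝ) : ((2 : ℝ) • (B * Bᵀ) - 1).IsSymm := by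
  rw [Matrix.IsSymm, Matrix.transpose_sub, Matrix.transpose_smul, Matrix.transpose_mul,
    Matrix.transpose_transpose, Matrix.transpose_one]

theorem reflection_mul_self [DecidableEq ι] {B : Matrix (Fin n) ι ℝ} (hB : Bᵀ * B = 1) :
    ((2 : ℝ) • (B * Bᵀ) - 1) * ((2 : ℝ) • (B * Bᵀ) - 1) = 1 := by
  rw [sub_mul, mul_sub, smul_mul_smul_comm, projection_mul_self hB, one_mul, mul_one, ← smul_smul,
    two_smul ℝ ((2 : ℝ) • _)]
  abel

theorem eigenspace_reflection [DecidableEq ι] {B : Matrix (Fin n) ι ℝ} (hB : Bᵀ * B = 1) :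
    Module.End.eigenspace (Matrix.toLin' ((2 : ℝ) • (B * Bᵀ) - 1)) 1 =
      LinearMap.range (Matrix.toLin' B) := by
  ext v
  rw [mem_eigenspace_one, Matrix.sub_mulVec, Matrix.one_mulVec, Matrix.smul_mulVec,
    sub_eq_iff_eq_add, ← two_smul ℝ, (smul_right_injective _ (two_ne_zero (α := ℝ))).eq_iff]
  constructor
  · intro h
    exact ⟨Bᵀ *ᵥ v, by rw [Matrix.toLin'_apply, Matrix.mulVec_mulVec, h]⟩
  · rintro ⟨x, rfl⟩
    rw [Matrix.toLin'_apply, Matrix.mulVec_mulVec, Matrix.mul_assoc, hB, Matrix.mul_one]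

end Reflection

/-- Every subspace of `ℝⁿ` is the eigenspace for the eigenvalue `1` of the orthogonal reflection
across it. -/
theorem exists_reflection {n : ℕ} (W : Submodule ℝ (Fin n → ℝ)) :
    ∃ N : OrthGroup n, (N : Matrix (Fin n) (Fin n) ℝ).IsSymm ∧
      Module.End.eigenspace (Matrix.toLin' (N : Matrix (Fin n) (Fin n) ℝ)) 1 = W := by
  obtain ⟨B, hB, hW⟩ := exists_orthonormal_columns (ι := Fin (Module.finrank ℝ W)) W (by simp)
  refine ⟨⟨(2 : ℝ) • (B * Bᵀ) - 1, (Matrix.mem_orthogonalGroup_iff (Fin n) ℝ).mpr ?_⟩,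
    isSymm_reflection B, (eigenspace_reflection hB).trans hW⟩
  refine Eq.trans ?_ (reflection_mul_self hB)
  exact congrArg _ (isSymm_reflection B).eq

noncomputable section

/-! ## Symmetric orthogonal matrices in the Cayley charts -/

/-- The skew symmetric matrices which anticommute with a given matrix. -/
def anticommuting {n : ℕ} (N : Matrix (Fin n) (Fin n) ℝ) : Submodule ℝ (SkewMatrix n) where
  carrier := {X | N * (X : Matrix (Fin n) (Fin n) ℝ) = -((X : Matrix (Fin n) (Fin n) ℝ) * N)}
  add_mem' := by
    intro a b (ha : _ = _) (hb : _ = _)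
    change N * ((a : Matrix (Fin n) (Fin n) ℝ) + b) = -(((a : Matrix (Fin n) (Fin n) ℝ) + b) * N)
    rw [mul_add, ha, hb, add_mul, neg_add]
  zero_mem' := by
    change N * (0 : Matrix (Fin n) (Fin n) ℝ) = -((0 : Matrix (Fin n) (Fin n) ℝ) * N)
    rw [mul_zero, zero_mul, neg_zero]
  smul_mem' := by
    intro c a (ha : _ = _)
    change N * (c • (a : Matrix (Fin n) (Fin n) ℝ)) = -((c • (a : Matrix (Fin n) (Fin n) ℝ)) * N)
    rw [mul_smul_comm, ha, smul_mul_assoc, smul_neg]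

theorem mem_anticommuting {n : ℕ} {N : Matrix (Fin n) (Fin n) ℝ} {X : SkewMatrix n} :
    X ∈ anticommuting N ↔
      N * (X : Matrix (Fin n) (Fin n) ℝ) = -((X : Matrix (Fin n) (Fin n) ℝ) * N) := Iff.rfl

theorem cayley_mul_one_add {n : ℕ} {X : Matrix (Fin n) (Fin n) ℝ} (h : Xᵀ = -X) :
    cayley X * (1 + X) = 1 - X := by
  rw [cayley, mul_assoc, Matrix.nonsing_inv_mul _ (isUnit_det_one_add_skew h), mul_one]

/-- If `X` anticommutes with `N` then `1 + X` conjugates `N` to `N * cayley X`. -/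
theorem mul_cayley_mul_one_add {n : ℕ} {N : Matrix (Fin n) (Fin n) ℝ} {X : SkewMatrix n}
    (hX : X ∈ anticommuting N) :
    N * cayley (X : Matrix (Fin n) (Fin n) ℝ) * (1 + (X : Matrix (Fin n) (Fin n) ℝ)) =
      (1 + (X : Matrix (Fin n) (Fin n) ℝ)) * N := by
  rw [mul_assoc, cayley_mul_one_add X.2, mul_sub, mem_anticommuting.mp hX, add_mul, mul_one,
    one_mul, sub_neg_eq_add]

theorem eq_of_mul_one_add_eq {n : ℕ} {X A B : Matrix (Fin n) (Fin n) ℝ} (h : Xᵀ = -X)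
    (hAB : A * (1 + X) = B * (1 + X)) : A = B := by
  have := congrArg (· * (1 + X)⁻¹) hAB
  simpa only [mul_assoc, Matrix.mul_nonsing_inv _ (isUnit_det_one_add_skew h), mul_one] using this

/-- For an orthogonal matrix, being symmetric means being an involution. If `N * cayley X` squares
to `1`, clearing the denominators `1 + X` leaves `NX + XN = 0`. Conversely, anticommutation makes `N
* cayley X` conjugate to `N` by `1 + X`, hence an involution. -/
theorem isSymm_mul_cayley_iff {n : ℕ} {N : OrthGroup n}
    (hN : (N : Matrix (Fin n) (Fin n) ℝ).IsSymm) (X : SkewMatrix n) :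
    ((N * cayleyOrth X : OrthGroup n) : Matrix (Fin n) (Fin n) ℝ).IsSymm ↔
      X ∈ anticommuting (N : Matrix (Fin n) (Fin n) ℝ) := by
  have hNN := OrthGroup.mul_self hN
  have hc : ((N * cayleyOrth X : OrthGroup n) : Matrix (Fin n) (Fin n) ℝ) =
    (N : Matrix (Fin n) (Fin n) ℝ) * cayley (X : Matrix (Fin n) (Fin n) ℝ) := rfl
  constructor
  · intro h
    have h1 := OrthGroup.mul_self h
    rw [hc] at h1
    have h2 : (N : Matrix (Fin n) (Fin n) ℝ) * (1 + (X : Matrix (Fin n) (Fin n) ℝ)) =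
        cayley (X : Matrix (Fin n) (Fin n) ℝ) * N * (1 - (X : Matrix (Fin n) (Fin n) ℝ)) := by
      rw [← cayley_mul_one_add X.2]
      have h3 : cayley (X : Matrix (Fin n) (Fin n) ℝ) * N * cayley (X : Matrix (Fin n) (Fin n) ℝ) =
          N := by
        have := congrArg ((N : Matrix (Fin n) (Fin n) ℝ) * ·) h1
        simpa only [← mul_assoc, hNN, one_mul, mul_one] using this
      rw [← mul_assoc, h3]
    have h4 : (1 + (X : Matrix (Fin n) (Fin n) ℝ)) * cayley (X : Matrix (Fin n) (Fin n) ℝ) =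
        1 - (X : Matrix (Fin n) (Fin n) ℝ) := by
      apply eq_of_mul_one_add_eq X.2
      rw [mul_assoc, cayley_mul_one_add X.2]
      noncomm_ring
    -- This becomes `(1 + X) N (1 + X) = (1 - X) N (1 - X)`, in which the terms of even degree in
    -- `X` cancel.
    have h5 := congrArg ((1 + (X : Matrix (Fin n) (Fin n) ℝ)) * ·) h2
    simp only [← mul_assoc, h4] at h5
    have h6 : (2 : ℝ) • ((N : Matrix (Fin n) (Fin n) ℝ) * (X : Matrix (Fin n) (Fin n) ℝ) +
        (X : Matrix (Fin n) (Fin n) ℝ) * N) = 0 := by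
      rw [two_smul]
      simp only [add_mul, mul_add, sub_mul, mul_sub, one_mul, mul_one] at h5
      rw [← sub_eq_zero] at h5
      rw [← h5]; abel
    exact eq_neg_of_add_eq_zero_left ((smul_eq_zero.mp h6).resolve_left two_ne_zero)
  · intro hX
    apply isSymm_of_mul_self
    rw [hc]
    apply eq_of_mul_one_add_eq X.2
    rw [mul_assoc, mul_cayley_mul_one_add hX, ← mul_assoc, mul_cayley_mul_one_add hX, mul_assoc,
      hNN, mul_one, one_mul]

/-- If `X` anticommutes with `N`, then `1 + X` carries the eigenspaces of `N` to those of
`N * cayley X`. -/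
theorem mem_eigenspace_mul_cayley {n : ℕ} {N : Matrix (Fin n) (Fin n) ℝ} {X : SkewMatrix n}
    (hX : X ∈ anticommuting N) (c : ℝ) (w : Fin n → ℝ) :
    (1 + (X : Matrix (Fin n) (Fin n) ℝ)) *ᵥ w ∈ Module.End.eigenspace
      (Matrix.toLin' (N * cayley (X : Matrix (Fin n) (Fin n) ℝ))) c ↔
      w ∈ Module.End.eigenspace (Matrix.toLin' N) c := by
  have hinj : Function.Injective ((1 + (X : Matrix (Fin n) (Fin n) ℝ)) *ᵥ ·) :=
    Matrix.mulVec_injective_of_isUnit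
      ((Matrix.isUnit_iff_isUnit_det _).mpr (isUnit_det_one_add_skew X.2))
  rw [mem_eigenspace_toLin', mem_eigenspace_toLin', Matrix.mulVec_mulVec,
    mul_cayley_mul_one_add hX, ← Matrix.mulVec_mulVec, ← Matrix.mulVec_smul]
  exact hinj.eq_iff

theorem eigenspace_mul_cayley {n : ℕ} {N : Matrix (Fin n) (Fin n) ℝ} {X : SkewMatrix n}
    (hX : X ∈ anticommuting N) (c : ℝ) :
    Module.End.eigenspace (Matrix.toLin' (N * cayley (X : Matrix (Fin n) (Fin n) ℝ))) c =
      (Module.End.eigenspace (Matrix.toLin' N) c).map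
        (Matrix.toLin' (1 + (X : Matrix (Fin n) (Fin n) ℝ))) := by
  ext v
  have hu := isUnit_det_one_add_skew X.2
  rw [Submodule.mem_map]
  constructor
  · intro hv
    have hw : (1 + (X : Matrix (Fin n) (Fin n) ℝ)) *ᵥ
        ((1 + (X : Matrix (Fin n) (Fin n) ℝ))⁻¹ *ᵥ v) = v := by
      rw [Matrix.mulVec_mulVec, Matrix.mul_nonsing_inv _ hu, Matrix.one_mulVec]
    refine ⟨_, (mem_eigenspace_mul_cayley hX c _).mp ?_, hw⟩
    rwa [hw]
  · rintro ⟨w, hw, rfl⟩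
    exact (mem_eigenspace_mul_cayley hX c w).mpr hw

theorem finrank_eigenspace_mul_cayley {n : ℕ} {N : Matrix (Fin n) (Fin n) ℝ} {X : SkewMatrix n}
    (hX : X ∈ anticommuting N) (c : ℝ) :
    Module.finrank ℝ (Module.End.eigenspace
      (Matrix.toLin' (N * cayley (X : Matrix (Fin n) (Fin n) ℝ))) c) =
      Module.finrank ℝ (Module.End.eigenspace (Matrix.toLin' N) c) := by
  have hinj : Function.Injective (Matrix.toLin' (1 + (X : Matrix (Fin n) (Fin n) ℝ))) :=
    Matrix.mulVec_injective_of_isUnit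
      ((Matrix.isUnit_iff_isUnit_det _).mpr (isUnit_det_one_add_skew X.2))
  rw [eigenspace_mul_cayley hX]
  exact (Submodule.equivMapOfInjective _ hinj _).finrank_eq.symm

/-- Symmetry is the only condition: once it holds, the invertible matrix `1 + X` carries eigenspaces
to eigenspaces, so the multiplicities are preserved. -/
theorem mul_cayleyOrth_mem_symmOrth_iff {n p m : ℕ} {N : OrthGroup n} (hN : N ∈ SymmOrth n p m)
    (X : SkewMatrix n) :
    N * cayleyOrth X ∈ SymmOrth n p m ↔
      X ∈ anticommuting (N : Matrix (Fin n) (Fin n) ℝ) := by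
  rw [← isSymm_mul_cayley_iff hN.1]
  refine ⟨fun h => h.1, fun h => ⟨h, ?_, ?_⟩⟩
  · exact (finrank_eigenspace_mul_cayley ((isSymm_mul_cayley_iff hN.1 X).mp h) 1).trans hN.2.1
  · exact (finrank_eigenspace_mul_cayley ((isSymm_mul_cayley_iff hN.1 X).mp h) (-1)).trans hN.2.2

theorem mem_cayleyChart_source_self {n : ℕ} (Q : OrthGroup n) : Q ∈ (cayleyChart Q).source :=
  mem_chart_source (SkewMatrix n) Q

theorem cayleyChart_mul_cayleyOrth {n : ℕ} (Q : OrthGroup n) (X : SkewMatrix n) :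
    cayleyChart Q (Q * cayleyOrth X) = X :=
  (cayleyChart Q).right_inv (Set.mem_univ X)

theorem mul_cayleyOrth_cayleyChart {n : ℕ} {Q R : OrthGroup n} (hR : R ∈ (cayleyChart Q).source) :
    Q * cayleyOrth (cayleyChart Q R) = R :=
  (cayleyChart Q).left_inv hR

theorem mul_cayleyOrth_mem_source {n : ℕ} (Q : OrthGroup n) (X : SkewMatrix n) :
    Q * cayleyOrth X ∈ (cayleyChart Q).source :=
  (cayleyChart Q).map_target (Set.mem_univ X)

theorem mul_mem_diametralPiece {n q : ℕ} {G N : OrthGroup n} :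
    G * N ∈ diametralPiece G q ↔ N ∈ SymmOrth n (n - 2 * q) (2 * q) :=
  ⟨fun ⟨_, h, h'⟩ => mul_left_cancel h' ▸ h, fun h => ⟨N, h, rfl⟩⟩

/-- The Cayley chart centred at `G * N` straightens the piece to `anticommuting N`; the chart is
onto the model space, so the slice is the whole subspace. -/
theorem isSubmanifold_diametralPiece {n : ℕ} (G : OrthGroup n) (q : ℕ) :
    IsSubmanifold (SkewMatrix n) (diametralPiece G q) := by
  rintro _ ⟨N, hN, rfl⟩
  refine ⟨cayleyChart (G * N), IsManifold.chart_mem_maximalAtlas (G * N),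
    mem_cayleyChart_source_self _, anticommuting (N : Matrix (Fin n) (Fin n) ℝ), ?_⟩
  ext X
  constructor
  · rintro ⟨R, ⟨hR, hR'⟩, rfl⟩
    refine ⟨Set.mem_univ _, ?_⟩
    rw [← mul_cayleyOrth_cayleyChart hR, mul_assoc, mul_mem_diametralPiece,
      mul_cayleyOrth_mem_symmOrth_iff hN] at hR'
    exact hR'
  · rintro ⟨-, hX⟩
    refine ⟨G * N * cayleyOrth X, ⟨mul_cayleyOrth_mem_source _ X, ?_⟩,
      cayleyChart_mul_cayleyOrth _ X⟩
    rw [mul_assoc, mul_mem_diametralPiece, mul_cayleyOrth_mem_symmOrth_iff hN]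
    exact hX

end

noncomputable section

/-! ## The embedding of the Grassmannian -/

/-- A splitting of `ℝⁿ` is adapted to the matrix `N` if `N` acts as `1` on the first summand and as
`-1` on the second one. -/
def GrFrame.IsAdapted {p n : ℕ} (e : GrFrame p n) (N : Matrix (Fin n) (Fin n) ℝ) : Prop :=
  ∀ x y, N *ᵥ e (x, y) = e (x, -y)

theorem exists_isAdapted {p n : ℕ} {N : Matrix (Fin n) (Fin n) ℝ} (hN : N * N = 1)
    (hp : Module.finrank ℝ (Module.End.eigenspace (Matrix.toLin' N) 1) = p) :
    ∃ e : GrFrame p n, e.IsAdapted N := by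
  have hm : Module.finrank ℝ (Module.End.eigenspace (Matrix.toLin' N) (-1)) = n - p := by
    have := finrank_eigenspace_add hN
    omega
  let f : (Fin p → ℝ) ≃ₗ[ℝ] Module.End.eigenspace (Matrix.toLin' N) 1 :=
    LinearEquiv.ofFinrankEq _ _ (by rw [hp, Module.finrank_fin_fun])
  let g : (Fin (n - p) → ℝ) ≃ₗ[ℝ] Module.End.eigenspace (Matrix.toLin' N) (-1) :=
    LinearEquiv.ofFinrankEq _ _ (by rw [hm, Module.finrank_fin_fun])
  let e : ((Fin p → ℝ) × (Fin (n - p) → ℝ)) ≃ₗ[ℝ] (Fin n → ℝ) :=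
    (f.prodCongr g).trans (Submodule.prodEquivOfIsCompl _ _ (isCompl_eigenspace hN))
  refine ⟨e.toContinuousLinearEquiv, fun x y => ?_⟩
  change N *ᵥ ((f x : Fin n → ℝ) + (g y : Fin n → ℝ)) = (f x : Fin n → ℝ) + (g (-y) : Fin n → ℝ)
  rw [Matrix.mulVec_add, mem_eigenspace_one.mp (f x).2, mem_eigenspace_neg_one.mp (g y).2, map_neg]
  rfl

theorem GrFrame.IsAdapted.mem_eigenspace_one_iff {p n : ℕ} {e : GrFrame p n}
    {N : Matrix (Fin n) (Fin n) ℝ} (he : e.IsAdapted N) (v : Fin n → ℝ) :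
    v ∈ Module.End.eigenspace (Matrix.toLin' N) 1 ↔ (e.symm v).2 = 0 := by
  obtain ⟨⟨x, y⟩, rfl⟩ := e.surjective v
  rw [mem_eigenspace_one, he, e.injective.eq_iff, e.symm_apply_apply, Prod.mk.injEq]
  simp [neg_eq_self]

theorem GrFrame.IsAdapted.mem_eigenspace_neg_one_iff {p n : ℕ} {e : GrFrame p n}
    {N : Matrix (Fin n) (Fin n) ℝ} (he : e.IsAdapted N) (v : Fin n → ℝ) :
    v ∈ Module.End.eigenspace (Matrix.toLin' N) (-1) ↔ (e.symm v).1 = 0 := by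
  obtain ⟨⟨x, y⟩, rfl⟩ := e.surjective v
  rw [mem_eigenspace_neg_one, he, ← map_neg, e.injective.eq_iff, e.symm_apply_apply]
  simp [self_eq_neg]

theorem GrFrame.IsAdapted.grParam_zero {p n : ℕ} {e : GrFrame p n}
    {N : Matrix (Fin n) (Fin n) ℝ} (he : e.IsAdapted N) :
    (grParam e 0).1 = Module.End.eigenspace (Matrix.toLin' N) 1 := by
  ext v
  rw [mem_grParam, he.mem_eigenspace_one_iff]
  rfl

/-- The matrix of the linear map `e (x, y) ↦ e (0, T x)`. -/
def frameMatrix {p n : ℕ} (e : GrFrame p n) : GrModel p n →ₗ[ℝ] Matrix (Fin n) (Fin n) ℝ where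
  toFun T := LinearMap.toMatrix' ((e.toContinuousLinearMap ∘L ContinuousLinearMap.inr ℝ _ _ ∘L T ∘L
    ContinuousLinearMap.fst ℝ _ _ ∘L e.symm.toContinuousLinearMap :
      (Fin n → ℝ) →L[ℝ] (Fin n → ℝ)) : (Fin n → ℝ) →ₗ[ℝ] (Fin n → ℝ))
  map_add' S T := by
    rw [← map_add]
    congr 1
    ext1 x
    simp
  map_smul' c T := by
    rw [RingHom.id_apply, ← map_smul]
    congr 1
    ext1 x
    simp

theorem frameMatrix_mulVec {p n : ℕ} (e : GrFrame p n) (T : GrModel p n) (v : Fin n → ℝ) :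
    frameMatrix e T *ᵥ v = e (0, T (e.symm v).1) := by
  rw [← Matrix.toLin'_apply]
  simp [frameMatrix]

/-- The skew symmetric matrix attached to a linear map from the first to the second summand of a
splitting. -/
def frameSkew {p n : ℕ} (e : GrFrame p n) : GrModel p n →L[ℝ] SkewMatrix n :=
  -- The factor `2` cancels the half in `skewPart`, so that the block from the first summand to the
  -- second is exactly `T`.
  (2 : ℝ) • skewPart n ∘L LinearMap.toContinuousLinearMap (frameMatrix e)

theorem coe_frameSkew {p n : ℕ} (e : GrFrame p n) (T : GrModel p n) :
    (frameSkew e T : Matrix (Fin n) (Fin n) ℝ) = frameMatrix e T - (frameMatrix e T)ᵀ := by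
  change (2 : ℝ) • ((1 / 2 : ℝ) • (frameMatrix e T - (frameMatrix e T)ᵀ)) = _
  rw [smul_smul]
  norm_num

/-- The block from the first to the second summand of a splitting of a skew symmetric matrix. -/
def frameBlock {p n : ℕ} (e : GrFrame p n) : SkewMatrix n →L[ℝ] GrModel p n :=
  LinearMap.toContinuousLinearMap
    { toFun X := ContinuousLinearMap.snd ℝ _ _ ∘L e.symm.toContinuousLinearMap ∘L
        LinearMap.toContinuousLinearMap (Matrix.toLin' (X : Matrix (Fin n) (Fin n) ℝ)) ∘L
        e.toContinuousLinearMap ∘L ContinuousLinearMap.inl ℝ _ _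
      map_add' X Y := by
        ext1 x
        simp
      map_smul' c X := by
        ext1 x
        simp }

theorem frameBlock_apply {p n : ℕ} (e : GrFrame p n) (X : SkewMatrix n) (x : Fin p → ℝ) :
    frameBlock e X x = (e.symm ((X : Matrix (Fin n) (Fin n) ℝ) *ᵥ e (x, 0))).2 := rfl

/-! ### Anticommuting skew matrices as blocks of an adapted splitting -/

section Adapted

variable {p n : ℕ} {e : GrFrame p n} {N : Matrix (Fin n) (Fin n) ℝ}

/-- `frameMatrix e T` takes values in the `-1`-eigenspace and kills it. This identity, the next one
and their transposes together make `frameSkew e T` anticommute with `N`. -/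
theorem GrFrame.IsAdapted.mul_frameMatrix (he : e.IsAdapted N) (T : GrModel p n) :
    N * frameMatrix e T = -frameMatrix e T := by
  refine Matrix.toLin'.injective (LinearMap.ext fun v => ?_)
  rw [Matrix.toLin'_apply, Matrix.toLin'_apply, ← Matrix.mulVec_mulVec, Matrix.neg_mulVec,
    frameMatrix_mulVec, he, ← map_neg e, Prod.neg_mk, neg_zero]

theorem GrFrame.IsAdapted.frameMatrix_mul (he : e.IsAdapted N) (T : GrModel p n) :
    frameMatrix e T * N = frameMatrix e T := by
  refine Matrix.toLin'.injective (LinearMap.ext fun v => ?_)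
  obtain ⟨⟨x, y⟩, rfl⟩ := e.surjective v
  rw [Matrix.toLin'_apply, Matrix.toLin'_apply, ← Matrix.mulVec_mulVec, he,
    frameMatrix_mulVec, frameMatrix_mulVec, e.symm_apply_apply, e.symm_apply_apply]

theorem GrFrame.IsAdapted.mul_transpose_frameMatrix (he : e.IsAdapted N) (hN : N.IsSymm)
    (T : GrModel p n) : N * (frameMatrix e T)ᵀ = (frameMatrix e T)ᵀ := by
  have := congrArg Matrix.transpose (he.frameMatrix_mul T)
  rwa [Matrix.transpose_mul, hN.eq] at this

theorem GrFrame.IsAdapted.transpose_frameMatrix_mul (he : e.IsAdapted N) (hN : N.IsSymm)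
    (T : GrModel p n) : (frameMatrix e T)ᵀ * N = -(frameMatrix e T)ᵀ := by
  have := congrArg Matrix.transpose (he.mul_frameMatrix T)
  rwa [Matrix.transpose_mul, hN.eq, Matrix.transpose_neg] at this

theorem GrFrame.IsAdapted.frameSkew_mem (he : e.IsAdapted N) (hN : N.IsSymm) (T : GrModel p n) :
    frameSkew e T ∈ anticommuting N := by
  rw [mem_anticommuting, coe_frameSkew, mul_sub, sub_mul, he.mul_frameMatrix,
    he.mul_transpose_frameMatrix hN, he.frameMatrix_mul, he.transpose_frameMatrix_mul hN]
  abel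

/-- On the `1`-eigenspace the transposed block vanishes: `Mᵀ N = -Mᵀ` gives `Mᵀ w = -Mᵀ w` whenever
`N w = w`. Symmetry of `N` enters here, through the orthogonality of its eigenspaces. -/
theorem GrFrame.IsAdapted.frameSkew_mulVec (he : e.IsAdapted N) (hN : N.IsSymm)
    (T : GrModel p n) (x : Fin p → ℝ) :
    (frameSkew e T : Matrix (Fin n) (Fin n) ℝ) *ᵥ e (x, 0) = e (0, T x) := by
  have h1 : (frameMatrix e T)ᵀ *ᵥ e (x, 0) = 0 := by
    have h2 := congrArg (· *ᵥ e (x, 0)) (he.transpose_frameMatrix_mul hN T)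
    simp only [← Matrix.mulVec_mulVec, he x 0, neg_zero, Matrix.neg_mulVec] at h2
    exact self_eq_neg.mp h2
  rw [coe_frameSkew, Matrix.sub_mulVec, h1, sub_zero, frameMatrix_mulVec, e.symm_apply_apply]

theorem GrFrame.IsAdapted.frameBlock_frameSkew (he : e.IsAdapted N) (hN : N.IsSymm)
    (T : GrModel p n) : frameBlock e (frameSkew e T) = T := by
  ext1 x
  rw [frameBlock_apply, he.frameSkew_mulVec hN, e.symm_apply_apply]

/-- An anticommuting skew matrix is determined by its values on the `1`-eigenspace. The difference
`Y` of the two sides vanishes there, so `YN = -Y`; transposing, `NY = -Y`; but anticommutation gives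
`NY = -YN = Y`, hence `Y = 0`. -/
theorem GrFrame.IsAdapted.frameSkew_frameBlock (he : e.IsAdapted N) (hN : N.IsSymm)
    {X : SkewMatrix n} (hX : X ∈ anticommuting N) : frameSkew e (frameBlock e X) = X := by
  rw [← sub_eq_zero]
  have hY : frameSkew e (frameBlock e X) - X ∈ anticommuting N :=
    Submodule.sub_mem _ (he.frameSkew_mem hN _) hX
  have hY0 : ∀ x, ((frameSkew e (frameBlock e X) - X : SkewMatrix n) :
      Matrix (Fin n) (Fin n) ℝ) *ᵥ e (x, 0) = 0 := by
    intro x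
    -- Anticommuting with `N`, the matrix `X` carries the `1`-eigenspace into the `-1`-eigenspace.
    have h1 : (e.symm ((X : Matrix (Fin n) (Fin n) ℝ) *ᵥ e (x, 0))).1 = 0 := by
      rw [← he.mem_eigenspace_neg_one_iff, mem_eigenspace_neg_one, Matrix.mulVec_mulVec,
        mem_anticommuting.mp hX, Matrix.neg_mulVec, ← Matrix.mulVec_mulVec, he, neg_zero]
    have h2 : (X : Matrix (Fin n) (Fin n) ℝ) *ᵥ e (x, 0) = e (0, frameBlock e X x) := by
      rw [← e.symm_apply_eq, frameBlock_apply]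
      exact Prod.ext h1 rfl
    rw [Submodule.coe_sub, Matrix.sub_mulVec, he.frameSkew_mulVec hN, h2, sub_self]
  generalize frameSkew e (frameBlock e X) - X = Y at hY hY0
  have hYN : (Y : Matrix (Fin n) (Fin n) ℝ) * N = -Y := by
    refine Matrix.toLin'.injective (LinearMap.ext fun v => ?_)
    obtain ⟨⟨x, y⟩, rfl⟩ := e.surjective v
    have hxy : e (x, -y) = (2 : ℝ) • e (x, 0) - e (x, y) := by
      rw [← map_smul, ← map_sub]
      simp [two_smul]
    rw [Matrix.toLin'_apply, Matrix.toLin'_apply, ← Matrix.mulVec_mulVec, he, hxy,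
      Matrix.mulVec_sub, Matrix.mulVec_smul, hY0, smul_zero, zero_sub, Matrix.neg_mulVec]
  have hNY : N * (Y : Matrix (Fin n) (Fin n) ℝ) = -Y := by
    have hYt : (Y : Matrix (Fin n) (Fin n) ℝ)ᵀ = -Y := Y.2
    have := congrArg Matrix.transpose hYN
    rwa [Matrix.transpose_mul, Matrix.transpose_neg, hYt, hN.eq, mul_neg, neg_inj] at this
  have h3 := mem_anticommuting.mp hY
  rw [hNY, hYN, neg_neg] at h3
  have h4 : (2 : ℝ) • (Y : Matrix (Fin n) (Fin n) ℝ) = 0 := by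
    rw [two_smul]
    nth_rewrite 1 [← h3]
    exact neg_add_cancel _
  exact Subtype.ext ((smul_eq_zero.mp h4).resolve_left two_ne_zero)

end Adapted

/-- The orthogonal reflection across a subspace. -/
def grReflection {p n : ℕ} (W : Gr p n) : OrthGroup n := (exists_reflection W.1).choose

theorem grReflection_isSymm {p n : ℕ} (W : Gr p n) :
    (grReflection W : Matrix (Fin n) (Fin n) ℝ).IsSymm := (exists_reflection W.1).choose_spec.1

theorem eigenspace_grReflection {p n : ℕ} (W : Gr p n) :
    Module.End.eigenspace (Matrix.toLin' (grReflection W : Matrix (Fin n) (Fin n) ℝ)) 1 = W.1 :=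
  (exists_reflection W.1).choose_spec.2

/-- Makes the choice in `grReflection` harmless: a symmetric involution is determined by its fixed
space. -/
theorem eq_grReflection {p n : ℕ} {W : Gr p n} {N : OrthGroup n}
    (hN : (N : Matrix (Fin n) (Fin n) ℝ).IsSymm)
    (h : Module.End.eigenspace (Matrix.toLin' (N : Matrix (Fin n) (Fin n) ℝ)) 1 = W.1) :
    grReflection W = N :=
  Subtype.ext (eq_of_eigenspace_one_eq (grReflection_isSymm W) hN
    (OrthGroup.mul_self (grReflection_isSymm W)) (OrthGroup.mul_self hN)
    ((eigenspace_grReflection W).trans h.symm))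

theorem grReflection_injective (p n : ℕ) : Function.Injective (grReflection (p := p) (n := n)) := by
  intro W W' h
  apply Subtype.ext
  rw [← eigenspace_grReflection W, h, eigenspace_grReflection]

theorem grReflection_mem_symmOrth {p n : ℕ} (W : Gr p n) :
    grReflection W ∈ SymmOrth n p (n - p) := by
  have h1 := finrank_eigenspace_add (OrthGroup.mul_self (grReflection_isSymm W))
  have h2 : Module.finrank ℝ (Module.End.eigenspace
      (Matrix.toLin' (grReflection W : Matrix (Fin n) (Fin n) ℝ)) 1) = p := by
    rw [eigenspace_grReflection, W.2]
  exact ⟨grReflection_isSymm W, h2, by omega⟩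

theorem range_grReflection (p n : ℕ) :
    Set.range (grReflection (p := p) (n := n)) = SymmOrth n p (n - p) := by
  refine Set.Subset.antisymm ?_ fun N hN => ?_
  · rintro _ ⟨W, rfl⟩
    exact grReflection_mem_symmOrth W
  · exact ⟨⟨_, hN.2.1⟩, eq_grReflection hN.1 rfl⟩

/-- In the affine charts of the Grassmannian and the Cayley charts of the orthogonal group, the map
sending a subspace to the reflection across it is linear. -/
theorem grReflection_grParam {p n : ℕ} {e : GrFrame p n} {N : OrthGroup n}
    (he : e.IsAdapted (N : Matrix (Fin n) (Fin n) ℝ))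
    (hN : (N : Matrix (Fin n) (Fin n) ℝ).IsSymm) (T : GrModel p n) :
    grReflection (grParam e T) = N * cayleyOrth (frameSkew e T) := by
  have hX := he.frameSkew_mem hN T
  refine eq_grReflection ((isSymm_mul_cayley_iff hN _).mpr hX) ?_
  refine (eigenspace_mul_cayley hX 1).trans ?_
  -- `1 + frameSkew e T` carries the first summand, the `1`-eigenspace of `N`, onto the graph of
  -- `T`; by `eigenspace_mul_cayley` that graph is the new `1`-eigenspace.
  have key : ∀ x, (1 + (frameSkew e T : Matrix (Fin n) (Fin n) ℝ)) *ᵥ e (x, 0) = e (x, T x) := by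
    intro x
    rw [Matrix.add_mulVec, Matrix.one_mulVec, he.frameSkew_mulVec hN, ← map_add]
    simp
  ext v
  rw [Submodule.mem_map, mem_grParam]
  constructor
  · rintro ⟨w, hw, rfl⟩
    rw [he.mem_eigenspace_one_iff] at hw
    obtain ⟨⟨x, y⟩, rfl⟩ := e.surjective w
    rw [e.symm_apply_apply] at hw
    obtain rfl : y = 0 := hw
    rw [Matrix.toLin'_apply, key, e.symm_apply_apply]
  · intro hv
    refine ⟨e ((e.symm v).1, 0), ?_, ?_⟩
    · rw [he.mem_eigenspace_one_iff, e.symm_apply_apply]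
    · rw [Matrix.toLin'_apply, key, ← hv]
      exact e.apply_symm_apply v

/-- The affine chart of the Grassmannian attached to a splitting, with its topology. -/
def grOpenChart {p n : ℕ} (e : GrFrame p n) : OpenPartialHomeomorph (Gr p n) (GrModel p n) :=
  (grCore p n).openPartialHomeomorph (grChart e) (Set.mem_range_self e)

theorem grOpenChart_mem_maximalAtlas {p n : ℕ} (e : GrFrame p n) :
    grOpenChart e ∈ IsManifold.maximalAtlas 𝓘(ℝ, GrModel p n) ∞ (Gr p n) :=
  IsManifold.subset_maximalAtlas (Set.mem_iUnion₂.mpr ⟨grChart e, Set.mem_range_self e, rfl⟩)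

theorem continuous_grParam {p n : ℕ} (e : GrFrame p n) : Continuous (grParam e) :=
  continuousOn_univ.mp (grOpenChart e).continuousOn_invFun

/-- The preferred chart at `W` uses an arbitrary complement. This splitting uses the
`-1`-eigenspace, i.e. the orthogonal complement, for which the reflection map becomes linear. -/
theorem exists_isAdapted_grReflection {p n : ℕ} (W : Gr p n) :
    ∃ e : GrFrame p n, e.IsAdapted (grReflection W : Matrix (Fin n) (Fin n) ℝ) ∧
      grParam e 0 = W := by
  obtain ⟨e, he⟩ := exists_isAdapted (OrthGroup.mul_self (grReflection_isSymm W))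
    (by rw [eigenspace_grReflection, W.2])
  exact ⟨e, he, Subtype.ext (he.grParam_zero.trans (eigenspace_grReflection W))⟩

theorem continuous_cayleyOrth (n : ℕ) : Continuous (cayleyOrth (n := n)) := by
  have := continuousOn_univ.mp (cayleyChart (1 : OrthGroup n)).continuousOn_invFun
  exact this.congr fun X => one_mul (cayleyOrth X)

theorem continuousAt_mul_grReflection {p n : ℕ} (G : OrthGroup n) (W : Gr p n) :
    ContinuousAt (fun W : Gr p n => G * grReflection W) W := by
  obtain ⟨e, he, hW⟩ := exists_isAdapted_grReflection W
  have hs : W ∈ (grOpenChart e).symm.target := ⟨0, hW⟩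
  rw [(grOpenChart e).symm.continuousAt_iff_continuousAt_comp_right hs]
  have h1 : (fun W : Gr p n => G * grReflection W) ∘ (grOpenChart e).symm =
      fun T => G * (grReflection W * cayleyOrth (frameSkew e T)) := by
    funext T
    exact congrArg (G * ·) (grReflection_grParam he (grReflection_isSymm W) T)
  rw [h1]
  exact (continuous_const.mul (continuous_const.mul
    ((continuous_cayleyOrth n).comp (frameSkew e).continuous))).continuousAt

/-- An injective linear map with a left inverse is, up to an isomorphism, the inclusion of the
first factor of a product. -/
theorem exists_equiv_of_leftInverse {E F : Type*} [NormedAddCommGroup E] [NormedSpace ℝ E]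
    [NormedAddCommGroup F] [NormedSpace ℝ F] [FiniteDimensional ℝ E] [FiniteDimensional ℝ F]
    (S : E →L[ℝ] F) (R : F →L[ℝ] E) (h : Function.RightInverse S R) :
    ∃ Φ : (E × (Fin (Module.finrank ℝ F - Module.finrank ℝ E) → ℝ)) ≃L[ℝ] F,
      ∀ x, Φ (x, 0) = S x := by
  let Ψ : F ≃L[ℝ] E × R.ker := ContinuousLinearEquiv.equivOfRightInverse R S h
  have hd : Module.finrank ℝ (Fin (Module.finrank ℝ F - Module.finrank ℝ E) → ℝ) =
      Module.finrank ℝ R.ker := by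
    have := Ψ.toLinearEquiv.finrank_eq
    rw [Module.finrank_prod] at this
    rw [Module.finrank_fin_fun]
    omega
  refine ⟨((ContinuousLinearEquiv.refl ℝ E).prodCongr
    (ContinuousLinearEquiv.ofFinrankEq hd)).trans Ψ.symm, fun x => ?_⟩
  simp [Ψ]

/-- In the charts adapted to `W` the map reads `T ↦ frameSkew e T`, which has the linear left
inverse `frameBlock e`. The complement is chosen by dimension alone, so that one space serves at
every `W`. -/
theorem isImmersion_mul_grReflection {p n : ℕ} (G : OrthGroup n) :
    Manifold.IsImmersion 𝓘(ℝ, GrModel p n) 𝓘(ℝ, SkewMatrix n) ∞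
      (fun W : Gr p n => G * grReflection W) := by
  refine Manifold.IsImmersionOfComplement.isImmersion
    (F := Fin (Module.finrank ℝ (SkewMatrix n) - Module.finrank ℝ (GrModel p n)) → ℝ) fun W => ?_
  obtain ⟨e, he, hW⟩ := exists_isAdapted_grReflection W
  have hN := grReflection_isSymm W
  obtain ⟨Φ, hΦ⟩ := exists_equiv_of_leftInverse (frameSkew e) (frameBlock e)
    (he.frameBlock_frameSkew hN)
  refine Manifold.IsImmersionAtOfComplement.mk_of_continuousAt
    (continuousAt_mul_grReflection G W) Φ
    (grOpenChart e) (cayleyChart (G * grReflection W)) ⟨0, hW⟩ (mem_cayleyChart_source_self _)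
    (grOpenChart_mem_maximalAtlas e) (IsManifold.chart_mem_maximalAtlas (G * grReflection W))
    fun T _ => ?_
  change cayleyChart (G * grReflection W) (G * grReflection (grParam e T)) = Φ (T, 0)
  rw [hΦ, grReflection_grParam he hN, ← mul_assoc, cayleyChart_mul_cayleyOrth]

/-- Around each image point the map has a continuous left inverse `g`, obtained by reading the
Cayley coordinate, taking its block and forming the graph. Hence the topology of the Grassmannian is
the induced one. -/
theorem isEmbedding_mul_grReflection {p n : ℕ} (G : OrthGroup n) :
    Topology.IsEmbedding (fun W : Gr p n => G * grReflection W) := by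
  refine ⟨Topology.isInducing_iff_nhds.mpr fun W => le_antisymm
    (continuousAt_mul_grReflection G W).tendsto.le_comap ?_,
    fun W W' h => grReflection_injective p n (mul_left_cancel h)⟩
  obtain ⟨e, he, hW⟩ := exists_isAdapted_grReflection W
  have hN := grReflection_isSymm W
  let g : OrthGroup n → Gr p n :=
    fun R => grParam e (frameBlock e (cayleyChart (G * grReflection W) R))
  have hg : ∀ W', G * grReflection W' ∈ (cayleyChart (G * grReflection W)).source →
      g (G * grReflection W') = W' := by
    intro W' hW'
    have h1 := mul_cayleyOrth_cayleyChart hW'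
    change grParam e (frameBlock e (cayleyChart (G * grReflection W) (G * grReflection W'))) = W'
    generalize cayleyChart (G * grReflection W) (G * grReflection W') = X at h1
    rw [mul_assoc] at h1
    have h2 := mul_left_cancel h1
    -- The Cayley coordinate of another reflection anticommutes with the central one, so no
    -- information is lost in passing to its block.
    have hX : X ∈ anticommuting (grReflection W : Matrix (Fin n) (Fin n) ℝ) := by
      rw [← isSymm_mul_cayley_iff hN, h2]
      exact grReflection_isSymm W'
    apply grReflection_injective p n
    rw [grReflection_grParam he hN, he.frameSkew_frameBlock hN hX, h2]
  have hs := mem_cayleyChart_source_self (G * grReflection W)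
  have hgc : ContinuousAt g (G * grReflection W) :=
    ((continuous_grParam e).comp (frameBlock e).continuous).continuousAt.comp
      ((cayleyChart (G * grReflection W)).continuousAt hs)
  have hlim := hgc.tendsto.comp
    (Filter.tendsto_comap (f := fun W : Gr p n => G * grReflection W) (x := 𝓝 (G * grReflection W)))
  rw [hg W hs] at hlim
  refine Filter.Tendsto.congr' ?_ hlim (f₂ := id)
  filter_upwards [Filter.preimage_mem_comap
    ((cayleyChart (G * grReflection W)).open_source.mem_nhds hs)] with W' hW'
  exact hg W' hW'

theorem isSmoothEmbedding_mul_grReflection {p n : ℕ} (G : OrthGroup n) :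
    Manifold.IsSmoothEmbedding 𝓘(ℝ, GrModel p n) 𝓘(ℝ, SkewMatrix n) ∞
      (fun W : Gr p n => G * grReflection W) :=
  ⟨isImmersion_mul_grReflection G, isEmbedding_mul_grReflection G⟩

end

noncomputable section

/-! ## Geodesics of the orthogonal group -/

theorem HasDerivAt.transpose_matrix {n : ℕ} {c : ℝ → Matrix (Fin n) (Fin n) ℝ}
    {V : Matrix (Fin n) (Fin n) ℝ} {t : ℝ} (h : HasDerivAt c V t) :
    HasDerivAt (fun s => (c s)ᵀ) Vᵀ t :=
  (LinearMap.toContinuousLinearMap (Matrix.transposeLinearEquiv (Fin n) (Fin n) ℝ ℝ :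
    Matrix (Fin n) (Fin n) ℝ →ₗ[ℝ] Matrix (Fin n) (Fin n) ℝ)).hasFDerivAt.comp_hasDerivAt t h

/-- Differentiate `cᵀ c = 1`. -/
theorem transpose_mul_derivative {n : ℕ} {c : ℝ → OrthGroup n} {V : Matrix (Fin n) (Fin n) ℝ}
    {t : ℝ} (h : HasDerivAt (matrixCurve c) V t) :
    ((c t : Matrix (Fin n) (Fin n) ℝ)ᵀ * V)ᵀ = -((c t : Matrix (Fin n) (Fin n) ℝ)ᵀ * V) := by
  have h1 := h.transpose_matrix.mul h
  have h2 : (fun s => (matrixCurve c s)ᵀ) * matrixCurve c = fun _ => 1 := by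
    funext s
    exact (c s).transpose_mul
  rw [h2] at h1
  have h3 := h1.unique (hasDerivAt_const t 1)
  rw [Matrix.transpose_mul, Matrix.transpose_transpose]
  exact eq_neg_of_add_eq_zero_left h3

theorem skew_of_mem_tangentVectors {n : ℕ} {Q : OrthGroup n} {V : Matrix (Fin n) (Fin n) ℝ}
    (hV : V ∈ tangentVectors Q) :
    ((Q : Matrix (Fin n) (Fin n) ℝ)ᵀ * V)ᵀ = -((Q : Matrix (Fin n) (Fin n) ℝ)ᵀ * V) := by
  obtain ⟨c, -, rfl, h⟩ := hV
  exact transpose_mul_derivative h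

theorem contDiff_cayley_smul {n : ℕ} (X : SkewMatrix n) :
    ContDiff ℝ ∞ fun s : ℝ => cayley ((s • X : SkewMatrix n) : Matrix (Fin n) (Fin n) ℝ) := by
  rw [contDiff_iff_contDiffAt]
  intro s
  refine ContDiffAt.comp (g := cayley (n := n)) s
    (contDiffAt_cayley (isUnit_det_one_add_skew (s • X).2)) ?_
  exact contDiffAt_id.smul contDiffAt_const

/-- Differentiating `cayley (sX) (1 + sX) = 1 - sX` at `0` avoids the derivative of the inverse: it
gives `C' + X = -X`. -/
theorem hasDerivAt_cayley_smul {n : ℕ} (X : SkewMatrix n) :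
    HasDerivAt (fun s : ℝ => cayley ((s • X : SkewMatrix n) : Matrix (Fin n) (Fin n) ℝ))
      (-((2 : ℝ) • (X : Matrix (Fin n) (Fin n) ℝ))) 0 := by
  have hd := ((contDiff_cayley_smul X).differentiable (by simp) 0).hasDerivAt
  have hl : HasDerivAt (fun s : ℝ => s • (X : Matrix (Fin n) (Fin n) ℝ))
      (X : Matrix (Fin n) (Fin n) ℝ) 0 := by
    simpa using (hasDerivAt_id (0 : ℝ)).smul_const (X : Matrix (Fin n) (Fin n) ℝ)
  have h1 := hd.mul (hl.const_add 1)
  have h2 := hl.const_sub 1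
  have h3 : ((fun s : ℝ => cayley ((s • X : SkewMatrix n) : Matrix (Fin n) (Fin n) ℝ)) *
      fun s : ℝ => 1 + s • (X : Matrix (Fin n) (Fin n) ℝ)) =
      fun s : ℝ => 1 - s • (X : Matrix (Fin n) (Fin n) ℝ) := by
    funext s
    exact cayley_mul_one_add (s • X).2
  rw [h3] at h1
  have h4 := h1.unique h2
  have h5 : cayley (((0 : ℝ) • X : SkewMatrix n) : Matrix (Fin n) (Fin n) ℝ) = 1 := by
    rw [zero_smul, cayley]
    simp
  rw [h5, zero_smul, add_zero, mul_one, one_mul] at h4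
  have h6 : deriv (fun s : ℝ => cayley ((s • X : SkewMatrix n) : Matrix (Fin n) (Fin n) ℝ)) 0 =
      -((2 : ℝ) • (X : Matrix (Fin n) (Fin n) ℝ)) := by
    rw [eq_sub_of_add_eq h4, two_smul]
    abel
  rwa [h6] at hd

/-- With `skew_of_mem_tangentVectors`, this identifies the tangent space at `Q` with `Q` times the
skew matrices. The factor `-1/2` in the curve compensates for the derivative `-2X` of the Cayley
transform. -/
theorem mul_skew_mem_tangentVectors {n : ℕ} (Q : OrthGroup n) (X : SkewMatrix n) :
    (Q : Matrix (Fin n) (Fin n) ℝ) * (X : Matrix (Fin n) (Fin n) ℝ) ∈ tangentVectors Q := by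
  refine ⟨fun s => Q * cayleyOrth (s • ((-(1 / 2 : ℝ)) • X)), ?_, ?_, ?_⟩
  · exact contDiff_const.mul (contDiff_cayley_smul ((-(1 / 2 : ℝ)) • X))
  · have h : cayleyOrth (0 : SkewMatrix n) = 1 := by
      apply Subtype.ext
      change cayley (0 : Matrix (Fin n) (Fin n) ℝ) = 1
      simp [cayley]
    change Q * cayleyOrth ((0 : ℝ) • ((-(1 / 2 : ℝ)) • X)) = Q
    rw [zero_smul, h, mul_one]
  · have h := (hasDerivAt_cayley_smul ((-(1 / 2 : ℝ)) • X)).const_mul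
      (Q : Matrix (Fin n) (Fin n) ℝ)
    have h1 : -((2 : ℝ) • (((-(1 / 2 : ℝ)) • X : SkewMatrix n) : Matrix (Fin n) (Fin n) ℝ)) =
        X := by
      rw [Submodule.coe_smul, smul_smul, ← neg_smul]
      norm_num
    rwa [h1] at h

theorem trace_mul_eq_zero_of_isSymm_of_skew {n : ℕ} {S X : Matrix (Fin n) (Fin n) ℝ} (hS : S.IsSymm)
    (hX : Xᵀ = -X) : (S * X).trace = 0 := by
  have h : (S * X).trace = -(S * X).trace := by
    conv_lhs => rw [← Matrix.trace_transpose, Matrix.transpose_mul, hS.eq, hX, neg_mul,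
      Matrix.trace_neg, Matrix.trace_mul_comm]
  exact self_eq_neg.mp h

/-- A matrix which is orthogonal to all the skew symmetric matrices is symmetric. -/
theorem isSymm_of_orthogonal_skew {n : ℕ} {M : Matrix (Fin n) (Fin n) ℝ}
    (h : ∀ X : SkewMatrix n, frobeniusMetric M (X : Matrix (Fin n) (Fin n) ℝ) = 0) :
    M.IsSymm := by
  have hX : (M - Mᵀ)ᵀ = -(M - Mᵀ) := by
    rw [Matrix.transpose_sub, Matrix.transpose_transpose, neg_sub]
  -- Testing against `M - Mᵀ` itself: `h1` and `h2` combine to show that its squared Frobenius norm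
  -- is zero.
  have h1 : (Mᵀ * (M - Mᵀ)).trace = 0 := h ⟨M - Mᵀ, hX⟩
  have h2 : (M * (M - Mᵀ)).trace = 0 := by
    rw [← Matrix.trace_transpose, Matrix.transpose_mul, hX, neg_mul, Matrix.trace_neg,
      Matrix.trace_mul_comm, h1, neg_zero]
  have h3 : ((M - Mᵀ)ᵀ * (M - Mᵀ)).trace = 0 := by
    rw [Matrix.transpose_sub, Matrix.transpose_transpose, sub_mul, Matrix.trace_sub, h1, h2,
      sub_zero]
  have h4 : (M - Mᵀ)ᴴ * (M - Mᵀ) = (M - Mᵀ)ᵀ * (M - Mᵀ) := by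
    rw [Matrix.conjTranspose_eq_transpose_of_trivial]
  rw [← h4, Matrix.trace_conjTranspose_mul_self_eq_zero_iff] at h3
  exact (sub_eq_zero.mp h3).symm

theorem frobeniusMetric_orth_mul {n : ℕ} (Q : OrthGroup n) (V W : Matrix (Fin n) (Fin n) ℝ) :
    frobeniusMetric V ((Q : Matrix (Fin n) (Fin n) ℝ) * W) =
      frobeniusMetric ((Q : Matrix (Fin n) (Fin n) ℝ)ᵀ * V) W := by
  rw [frobeniusMetric, frobeniusMetric, Matrix.transpose_mul, Matrix.transpose_transpose, mul_assoc]

/-- A smooth curve `γ` of the orthogonal group is a geodesic if and only if `γᵀ γ''` is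
symmetric. -/
theorem isGeodesic_iff {n : ℕ} {γ : ℝ → OrthGroup n} (h : ContDiff ℝ ∞ (matrixCurve γ)) :
    IsGeodesic γ ↔ ∀ t, ((γ t : Matrix (Fin n) (Fin n) ℝ)ᵀ *
      deriv (deriv (matrixCurve γ)) t).IsSymm := by
  constructor
  · intro hγ t
    refine isSymm_of_orthogonal_skew fun X => ?_
    rw [← frobeniusMetric_orth_mul]
    exact hγ.2 t _ (mul_skew_mem_tangentVectors (γ t) X)
  · intro hγ
    refine ⟨h, fun t V hV => ?_⟩
    have h1 : V = (γ t : Matrix (Fin n) (Fin n) ℝ) * ((γ t : Matrix (Fin n) (Fin n) ℝ)ᵀ * V) := by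
      rw [← mul_assoc, (γ t).mul_transpose, one_mul]
    rw [h1, frobeniusMetric_orth_mul, frobeniusMetric, (hγ t).eq]
    exact trace_mul_eq_zero_of_isSymm_of_skew (hγ t) (skew_of_mem_tangentVectors hV)

/-- The geodesics of the orthogonal group are the translates of its one parameter subgroups. -/
theorem IsGeodesic.eq_mul_exp {n : ℕ} {γ : ℝ → OrthGroup n} (hγ : IsGeodesic γ) :
    ∃ A : Matrix (Fin n) (Fin n) ℝ, Aᵀ = -A ∧
      ∀ t : ℝ, matrixCurve γ t = matrixCurve γ 0 * NormedSpace.exp (t • A) := by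
  have hsymm : ∀ t, ((matrixCurve γ t)ᵀ * deriv (deriv (matrixCurve γ)) t)ᵀ =
      (matrixCurve γ t)ᵀ * deriv (deriv (matrixCurve γ)) t := (isGeodesic_iff hγ.1).mp hγ
  have hd : ∀ t, HasDerivAt (matrixCurve γ) (deriv (matrixCurve γ) t) t := fun t =>
    (hγ.1.differentiable (by simp) t).hasDerivAt
  have hdd : ∀ t, HasDerivAt (deriv (matrixCurve γ)) (deriv (deriv (matrixCurve γ)) t) t := by
    have : ContDiff ℝ ∞ (deriv (matrixCurve γ)) := (contDiff_infty_iff_deriv.mp hγ.1).2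
    exact fun t => (this.differentiable (by simp) t).hasDerivAt
  -- The velocity translated to the identity. Its derivative `D` is symmetric by the geodesic
  -- condition and skew because `Ω` is skew, so it vanishes and `Ω` is constant.
  let Ω : ℝ → Matrix (Fin n) (Fin n) ℝ := fun t => (matrixCurve γ t)ᵀ * deriv (matrixCurve γ) t
  have hΩ : ∀ t, (Ω t)ᵀ = -Ω t := fun t => transpose_mul_derivative (hd t)
  have hΩd : ∀ t, HasDerivAt Ω 0 t := by
    intro t
    have h1 := (hd t).transpose_matrix.mul (hdd t)
    set D := (deriv (matrixCurve γ) t)ᵀ * deriv (matrixCurve γ) t +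
      (matrixCurve γ t)ᵀ * deriv (deriv (matrixCurve γ)) t with hD
    have h2 : Dᵀ = D := by
      rw [hD, Matrix.transpose_add, hsymm t]
      congr 1
      rw [Matrix.transpose_mul, Matrix.transpose_transpose]
    have h3 : Dᵀ = -D := by
      have h4 : HasDerivAt (fun s => (Ω s)ᵀ) Dᵀ t := HasDerivAt.transpose_matrix h1
      have h5 : (fun s => (Ω s)ᵀ) = -Ω := funext hΩ
      rw [h5] at h4
      exact h4.unique (HasDerivAt.neg h1)
    have h6 : (2 : ℝ) • D = 0 := by
      rw [two_smul]
      nth_rewrite 1 [← h2]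
      rw [h3, neg_add_cancel]
    have h7 : D = 0 := (smul_eq_zero.mp h6).resolve_left two_ne_zero
    rw [← h7]
    exact h1
  have hconst : ∀ t, Ω t = Ω 0 := fun t =>
    is_const_of_deriv_eq_zero (fun s => (hΩd s).differentiableAt) (fun s => (hΩd s).deriv) t 0
  have hγ' : ∀ t, deriv (matrixCurve γ) t = matrixCurve γ t * Ω 0 := by
    intro t
    rw [← hconst t, ← mul_assoc]
    change _ = (γ t : Matrix (Fin n) (Fin n) ℝ) * (γ t : Matrix (Fin n) (Fin n) ℝ)ᵀ * _
    rw [(γ t).mul_transpose, one_mul]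
  refine ⟨Ω 0, hΩ 0, fun t => ?_⟩
  -- Uniqueness for the linear equation `γ' = γ Ω`: multiplied by the inverse exponential, the
  -- solution is constant.
  let E : ℝ → Matrix (Fin n) (Fin n) ℝ := fun s => matrixCurve γ s * NormedSpace.exp (s • (-Ω 0))
  have hE : ∀ s, HasDerivAt E 0 s := by
    intro s
    have h1 := (hd s).mul (hasDerivAt_exp_smul_const' (𝕂 := ℝ) (-Ω 0) s)
    rw [hγ', neg_mul, mul_neg, mul_assoc, add_neg_cancel] at h1
    exact h1
  have hE0 : E t = E 0 :=
    is_const_of_deriv_eq_zero (fun s => (hE s).differentiableAt) (fun s => (hE s).deriv) t 0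
  have hexp : NormedSpace.exp (t • (-Ω 0)) * NormedSpace.exp (t • Ω 0) = 1 := by
    rw [← Matrix.exp_add_of_commute, smul_neg, neg_add_cancel, NormedSpace.exp_zero]
    rw [smul_neg]
    exact (Commute.refl _).neg_left
  have h1 : E 0 = matrixCurve γ 0 := by
    change matrixCurve γ 0 * NormedSpace.exp ((0 : ℝ) • (-Ω 0)) = _
    rw [zero_smul, NormedSpace.exp_zero, mul_one]
  rw [← h1, ← hE0]
  change _ = matrixCurve γ t * NormedSpace.exp (t • (-Ω 0)) * _
  rw [mul_assoc, hexp, mul_one]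

/-- The eigenvalue `-1` of a square has even multiplicity. -/
theorem even_finrank_eigenspace_neg_one {n : ℕ} {N R : Matrix (Fin n) (Fin n) ℝ} (h : R * R = N) :
    Even (Module.finrank ℝ (Module.End.eigenspace (Matrix.toLin' N) (-1))) := by
  have hmaps : ∀ v ∈ Module.End.eigenspace (Matrix.toLin' N) (-1),
      Matrix.toLin' R v ∈ Module.End.eigenspace (Matrix.toLin' N) (-1) := by
    intro v hv
    rw [mem_eigenspace_neg_one] at hv ⊢
    rw [Matrix.toLin'_apply, ← Matrix.mulVec_neg, ← hv, Matrix.mulVec_mulVec, Matrix.mulVec_mulVec,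
      ← h, mul_assoc]
  let f := (Matrix.toLin' R).restrict hmaps
  have hf : f * f = (-1 : ℝ) • 1 := by
    ext1 v
    apply Subtype.ext
    change R *ᵥ (R *ᵥ (v : Fin n → ℝ)) = (-1 : ℝ) • (v : Fin n → ℝ)
    rw [Matrix.mulVec_mulVec, h, mem_eigenspace_neg_one.mp v.2, neg_one_smul]
  -- `R` preserves the eigenspace and squares to `-1` on it, so `(det f)² = (-1)^dim`, which is
  -- impossible over `ℝ` in odd dimension.
  have hdet := congrArg LinearMap.det hf
  rw [map_mul, LinearMap.det_smul, map_one, mul_one] at hdet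
  by_contra hodd
  rw [Nat.not_even_iff_odd] at hodd
  rw [hodd.neg_one_pow] at hdet
  linarith [mul_self_nonneg (LinearMap.det f)]

theorem IsWeaklyDiametral.exists_mem_diametralPiece {n : ℕ} {G H : OrthGroup n}
    (h : IsWeaklyDiametral G H) : ∃ q ≤ n / 2, H ∈ diametralPiece G q := by
  obtain ⟨-, γ, hγ, rfl, h1, h2⟩ := h
  obtain ⟨A, hA, hexp⟩ := hγ.eq_mul_exp
  have hN : ∀ t : ℝ, (((γ 0)⁻¹ * γ t : OrthGroup n) : Matrix (Fin n) (Fin n) ℝ) =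
      NormedSpace.exp (t • A) := by
    intro t
    change (γ 0 : Matrix (Fin n) (Fin n) ℝ)ᵀ * matrixCurve γ t = _
    rw [hexp, ← mul_assoc]
    change (γ 0 : Matrix (Fin n) (Fin n) ℝ)ᵀ * (γ 0 : Matrix (Fin n) (Fin n) ℝ) * _ = _
    rw [(γ 0).transpose_mul, one_mul]
  -- `γ (-1) = γ 1` says `exp(-A) = exp A`, while skewness of `A` gives `exp(-A) = (exp A)ᵀ`.
  have hsymm : (((γ 0)⁻¹ * H : OrthGroup n) : Matrix (Fin n) (Fin n) ℝ).IsSymm := by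
    have h3 := hN 1
    have h4 := hN (-1)
    rw [h1] at h3
    rw [h2] at h4
    have h5 : ((-1 : ℝ) • A) = ((1 : ℝ) • A)ᵀ := by
      rw [neg_one_smul, one_smul, hA]
    rw [h5, Matrix.exp_transpose, ← h3] at h4
    exact h4.symm
  have hsq : NormedSpace.exp ((1 / 2 : ℝ) • A) * NormedSpace.exp ((1 / 2 : ℝ) • A) =
      (((γ 0)⁻¹ * H : OrthGroup n) : Matrix (Fin n) (Fin n) ℝ) := by
    rw [← Matrix.exp_add_of_commute _ _ (Commute.refl _), ← add_smul, ← h1, hN]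
    norm_num
  obtain ⟨q, hq⟩ := even_finrank_eigenspace_neg_one hsq
  have hdim := finrank_eigenspace_add (OrthGroup.mul_self hsymm)
  refine ⟨q, by omega, (γ 0)⁻¹ * H, ⟨hsymm, by omega, by omega⟩, mul_inv_cancel_left _ _⟩

end

noncomputable section

/-! ## Weakly diametral pairs -/

/-- A symmetric involution with the eigenvalue `-1` of even multiplicity is `1 - 2P`, with `P` an
orthogonal projection whose range has an orthogonal complex structure `J`. -/
theorem exists_complex_structure {n p q : ℕ} {N : OrthGroup n} (hN : N ∈ SymmOrth n p (2 * q)) :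
    ∃ P J : Matrix (Fin n) (Fin n) ℝ, P.IsSymm ∧ Jᵀ = -J ∧ P * P = P ∧ P * J = J ∧ J * P = J ∧
      J * J = -P ∧ (N : Matrix (Fin n) (Fin n) ℝ) = 1 - (2 : ℝ) • P := by
  -- The columns of `B` form an orthonormal basis of the `-1`-eigenspace. Indexing them by `Fin q ⊕
  -- Fin q`, possible as the dimension is `2q`, lets the standard symplectic matrix `Matrix.J` be
  -- transported there.
  obtain ⟨B, hB, hW⟩ := exists_orthonormal_columns (ι := Fin q ⊕ Fin q) _
    (hN.2.2.trans (by rw [Fintype.card_sum, Fintype.card_fin, two_mul]))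
  have hBJ : ∀ C : Matrix (Fin q ⊕ Fin q) (Fin q ⊕ Fin q) ℝ, Bᵀ * (B * C) = C := by
    intro C
    rw [← Matrix.mul_assoc, hB, Matrix.one_mul]
  refine ⟨B * Bᵀ, B * (Matrix.J (Fin q) ℝ * Bᵀ), ?_, ?_, projection_mul_self hB, ?_, ?_, ?_, ?_⟩
  · rw [Matrix.IsSymm, Matrix.transpose_mul, Matrix.transpose_transpose]
  · rw [Matrix.transpose_mul, Matrix.transpose_mul, Matrix.transpose_transpose, Matrix.J_transpose,
      Matrix.mul_neg, Matrix.neg_mul, Matrix.mul_assoc]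
  · rw [Matrix.mul_assoc, ← Matrix.mul_assoc Bᵀ, hB, Matrix.one_mul]
  · rw [Matrix.mul_assoc, Matrix.mul_assoc, ← Matrix.mul_assoc Bᵀ, hB, Matrix.one_mul]
  · rw [Matrix.mul_assoc, Matrix.mul_assoc, ← Matrix.mul_assoc Bᵀ, hB, Matrix.one_mul,
      ← Matrix.mul_assoc (Matrix.J _ _), Matrix.J_squared, Matrix.neg_mul, Matrix.one_mul,
      Matrix.mul_neg]
  -- `-N` and `2BBᵀ - 1` are symmetric involutions with the same `1`-eigenspace, hence equal.
  · have hNs : (-(N : Matrix (Fin n) (Fin n) ℝ)).IsSymm := by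
      rw [Matrix.IsSymm, Matrix.transpose_neg, hN.1.eq]
    have hNN : -(N : Matrix (Fin n) (Fin n) ℝ) * -(N : Matrix (Fin n) (Fin n) ℝ) = 1 := by
      rw [neg_mul_neg, OrthGroup.mul_self hN.1]
    have he : Module.End.eigenspace (Matrix.toLin' (-(N : Matrix (Fin n) (Fin n) ℝ))) 1 =
        Module.End.eigenspace (Matrix.toLin' (N : Matrix (Fin n) (Fin n) ℝ)) (-1) := by
      ext v
      rw [mem_eigenspace_one, mem_eigenspace_neg_one, Matrix.neg_mulVec, neg_eq_iff_eq_neg]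
    have h := eq_of_eigenspace_one_eq hNs (isSymm_reflection B) hNN (reflection_mul_self hB)
      (he.trans (hW.symm.trans (eigenspace_reflection hB).symm))
    rw [← neg_eq_iff_eq_neg.mpr h.symm, neg_sub]

/-- The geodesic is `t ↦ G exp(πtJ)`. As `J² = -P`, the exponential is written as `1 - P + cos(πt) P
+ sin(πt) J`: a rotation on the range of `P`, the identity on its orthogonal complement. It equals
`1 - 2P = N` at `t = ±1`, and `γᵀ γ'' = -π² P` is symmetric. -/
theorem isWeaklyDiametral_of_mem_diametralPiece {n q : ℕ} {G H : OrthGroup n}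
    (h : H ∈ diametralPiece G q) : IsWeaklyDiametral G H := by
  obtain ⟨N, hN, rfl⟩ := h
  obtain ⟨P, J, hP, hJ, hPP, hPJ, hJP, hJJ, hNP⟩ := exists_complex_structure hN
  let D : ℝ → Matrix (Fin n) (Fin n) ℝ :=
    fun t => Real.cos (Real.pi * t) • P + Real.sin (Real.pi * t) • J
  let K : ℝ → Matrix (Fin n) (Fin n) ℝ := fun t => 1 - P + D t
  have hKt : ∀ t, (K t)ᵀ = 1 - P + (Real.cos (Real.pi * t) • P - Real.sin (Real.pi * t) • J) := by
    intro t
    simp only [K, D, Matrix.transpose_add, Matrix.transpose_sub, Matrix.transpose_smul, hP.eq, hJ,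
      Matrix.transpose_one, smul_neg, ← sub_eq_add_neg]
  have hDP : ∀ t, (1 - P) * D t = 0 := by
    intro t
    simp only [D, sub_mul, mul_add, one_mul, mul_smul_comm, hPP, hPJ, sub_self, smul_zero,
      add_zero]
  have hDD : ∀ t, (Real.cos (Real.pi * t) • P - Real.sin (Real.pi * t) • J) * D t = P := by
    intro t
    simp only [D, sub_mul, mul_add, smul_mul_smul_comm, hPP, hPJ, hJP, hJJ, smul_neg]
    rw [mul_comm (Real.sin (Real.pi * t)) (Real.cos (Real.pi * t))]
    have hcs : (Real.cos (Real.pi * t) * Real.cos (Real.pi * t)) • P +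
        (Real.sin (Real.pi * t) * Real.sin (Real.pi * t)) • P = P := by
      rw [← add_smul, ← sq, ← sq, Real.cos_sq_add_sin_sq, one_smul]
    refine Eq.trans ?_ hcs
    abel
  have hKD : ∀ t, (K t)ᵀ * D t = P := by
    intro t
    rw [hKt, add_mul, hDP, hDD, zero_add]
  have hKK : ∀ t, (K t)ᵀ * K t = 1 := by
    intro t
    change (K t)ᵀ * (1 - P + D t) = 1
    rw [mul_add, hKD, hKt]
    simp only [mul_sub, sub_mul, add_mul, mul_one, one_mul, smul_mul_assoc, hPP, hJP]
    abel
  let k : ℝ → OrthGroup n := fun t => ⟨K t, (Matrix.mem_orthogonalGroup_iff' (Fin n) ℝ).mpr (hKK t)⟩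
  have hcos : ∀ t : ℝ, HasDerivAt (fun s : ℝ => Real.cos (Real.pi * s))
      (-Real.sin (Real.pi * t) * Real.pi) t := by
    intro t
    have := ((hasDerivAt_id t).const_mul Real.pi).cos
    rwa [mul_one] at this
  have hsin : ∀ t : ℝ, HasDerivAt (fun s : ℝ => Real.sin (Real.pi * s))
      (Real.cos (Real.pi * t) * Real.pi) t := by
    intro t
    have := ((hasDerivAt_id t).const_mul Real.pi).sin
    rwa [mul_one] at this
  have hd1 : deriv (matrixCurve fun t => G * k t) = fun t => (G : Matrix (Fin n) (Fin n) ℝ) *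
      ((-Real.sin (Real.pi * t) * Real.pi) • P + (Real.cos (Real.pi * t) * Real.pi) • J) := by
    funext t
    exact (((((hcos t).smul_const P).add ((hsin t).smul_const J)).const_add (1 - P)).const_mul
      (G : Matrix (Fin n) (Fin n) ℝ)).deriv
  have hd2 : ∀ t, deriv (deriv (matrixCurve fun t => G * k t)) t =
      (G : Matrix (Fin n) (Fin n) ℝ) * ((-(Real.pi * Real.pi)) • D t) := by
    intro t
    rw [hd1]
    have h1 := (((((hsin t).neg.mul_const Real.pi).smul_const P).add
      (((hcos t).mul_const Real.pi).smul_const J)).const_mul (G : Matrix (Fin n) (Fin n) ℝ)).deriv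
    refine h1.trans (congrArg _ ?_)
    simp only [D, smul_add, smul_smul]
    congr 2 <;> ring
  have hsmooth : ContDiff ℝ ∞ (matrixCurve fun t => G * k t) := by
    refine contDiff_const.mul (contDiff_const.add (ContDiff.add ?_ ?_))
    · exact (Real.contDiff_cos.comp (contDiff_const.mul contDiff_id)).smul contDiff_const
    · exact (Real.contDiff_sin.comp (contDiff_const.mul contDiff_id)).smul contDiff_const
  have hgeo : IsGeodesic fun t => G * k t := by
    rw [isGeodesic_iff hsmooth]
    intro t
    have h1 : ((G * k t : OrthGroup n) : Matrix (Fin n) (Fin n) ℝ)ᵀ *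
        deriv (deriv (matrixCurve fun t => G * k t)) t = (-(Real.pi * Real.pi)) • P := by
      rw [hd2]
      change ((G : Matrix (Fin n) (Fin n) ℝ) * K t)ᵀ * _ = _
      rw [Matrix.transpose_mul, mul_assoc, ← mul_assoc (G : Matrix (Fin n) (Fin n) ℝ)ᵀ,
        G.transpose_mul, one_mul, mul_smul_comm, hKD]
    rw [h1]
    exact hP.smul _
  have h0 : k 0 = 1 := by
    apply Subtype.ext
    change 1 - P + (Real.cos (Real.pi * 0) • P + Real.sin (Real.pi * 0) • J) = 1
    simp
  have h1 : k 1 = N := by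
    apply Subtype.ext
    change 1 - P + (Real.cos (Real.pi * 1) • P + Real.sin (Real.pi * 1) • J) = N
    rw [hNP, two_smul, mul_one, Real.cos_pi, Real.sin_pi, neg_one_smul, zero_smul]
    abel
  have h2 : k (-1) = N := by
    apply Subtype.ext
    change 1 - P + (Real.cos (Real.pi * -1) • P + Real.sin (Real.pi * -1) • J) = N
    rw [hNP, two_smul, mul_neg_one, Real.cos_neg, Real.sin_neg, Real.cos_pi, Real.sin_pi,
      neg_one_smul, neg_zero, zero_smul]
    abel
  have hcont : Continuous fun t => G * k t := continuous_induced_rng.mpr hsmooth.continuous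
  refine ⟨?_, fun t => G * k t, hgeo, ?_, ?_, ?_⟩
  -- The geodesic itself joins the two points, so they lie in the same component.
  · refine (isPreconnected_range hcont).subset_connectedComponent ⟨0, ?_⟩ ⟨1, ?_⟩
    · exact (congrArg (G * ·) h0).trans (mul_one G)
    · exact congrArg (G * ·) h1
  · exact (congrArg (G * ·) h0).trans (mul_one G)
  · exact congrArg (G * ·) h1
  · exact congrArg (G * ·) h2

theorem pairwiseDisjoint_diametralPiece {n : ℕ} (G : OrthGroup n) (s : Set ℕ) :
    s.PairwiseDisjoint (diametralPiece G) := by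
  intro q _ q' _ hq
  refine Set.disjoint_left.mpr ?_
  rintro _ ⟨N, hN, rfl⟩ hN'
  rw [mul_mem_diametralPiece] at hN'
  have := hN.2.2.symm.trans hN'.2.2
  omega

theorem range_mul_grReflection {n q : ℕ} (G : OrthGroup n) (hq : q ≤ n / 2) :
    Set.range (fun W : Gr (n - 2 * q) n => G * grReflection W) = diametralPiece G q := by
  -- With truncated subtraction this needs `2q ≤ n`.
  have h1 : n - (n - 2 * q) = 2 * q := by omega
  have h2 := range_grReflection (n - 2 * q) n
  rw [h1] at h2
  rw [diametralPiece, ← h2, ← Set.range_comp]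
  rfl

end

/-- The diffeomorphism with the Grassmannian is expressed by a smooth embedding into the orthogonal
group whose image is the piece. -/
theorem mainTheorem10 (n : ℕ) (G : OrthGroup n) :
    ({H : OrthGroup n | IsWeaklyDiametral G H} = ⋃ q ∈ Set.Iic (n / 2), diametralPiece G q) ∧
    (Set.Iic (n / 2)).PairwiseDisjoint (diametralPiece G) ∧
    ∀ q ∈ Set.Iic (n / 2),
      IsSubmanifold (SkewMatrix n) (diametralPiece G q) ∧
      ∃ f : Gr (n - 2 * q) n → OrthGroup n,
        Manifold.IsSmoothEmbedding 𝓘(ℝ, GrModel (n - 2 * q) n) 𝓘(ℝ, SkewMatrix n) ∞ f ∧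
        Set.range f = diametralPiece G q := by
  refine ⟨?_, pairwiseDisjoint_diametralPiece G _, fun q hq =>
    ⟨isSubmanifold_diametralPiece G q, _, isSmoothEmbedding_mul_grReflection G,
      range_mul_grReflection G hq⟩⟩
  ext H
  rw [Set.mem_iUnion₂]
  constructor
  · intro h
    obtain ⟨q, hq, hH⟩ := h.exists_mem_diametralPiece
    exact ⟨q, hq, hH⟩
  · rintro ⟨q, -, hH⟩
    exact isWeaklyDiametral_of_mem_diametralPiece hH
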